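/- Let $\mathbb{T}^2=(\mathbb{R}/2\pi\mathbb{Z})^2$, let $s<0$, and let $\mu$ be the massive Gaussian free field on $H^s(\mathbb{T}^2)$, i.e. the law of the random Fourier series $$u(x)=\sum_{n\in\mathbb{Z}^2}\frac{g_n}{\sqrt{1+|n|^2}}\,e^{in\cdot x},$$ where $\{g_n\}_{n\in\mathbb{Z}^2}$ are independent standard complex Gaussian random variables ($\operatorname{Re} g_n$ and $\operatorname{Im} g_n$ are independent real Gaussians with mean $0$ and variance $\tfrac12$). For an integer $N\ge 0$ let $\mathbf{P}_N u(x)=\sum_{|n|\le N}\widehat u(n)e^{in\cdot x}$ and $\sigma_N=\sum_{|n|\le N}\frac{1}{1+|n|^2}$, where $|n|$ is the Euclidean length of $n\in\mathbb{Z}^2$. For an integer $m\ge 2$ let $L_m(x)=\sum_{\ell=0}^m\binom{m}{\ell}\frac{(-1)^\ell}{\ell!}x^\ell$ be the Laguerre polynomial and set $$:\!|\mathbf{P}_N u|^{2m}\!:\;=(-1)^m\,m!\,\sigma_N^m\,L_m\!\Big(\frac{|\mathbf{P}_N u|^2}{\sigma_N}\Big),\qquad G_N(u)=\frac1{2m}\int_{\mathbb{T}^2}:\!|\mathbf{P}_N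 u|^{2m}\!:\,dx .$$ **Proposition 1.1.** Let $m\ge2$ be an integer. Then, for every $1\le p<\infty$, each $G_N$ belongs to $L^p(\mu)$ and $\{G_N\}_N$ is a Cauchy sequence in $L^p(\mu)$. More precisely, there exists $C_m>0$, depending only on $m$, such that for all integers $M\ge N\ge1$ $$\|G_M-G_N\|_{L^p(\mu)}\le C_m\,(p-1)^m\,N^{-1/2}\quad(2\le p<\infty),\qquad \|G_M-G_N\|_{L^p(\mu)}\le C_m\,N^{-1/2}\quad(1\le p\le 2).$$ In particular there is a function $G$ (the Wick ordered potential energy $\frac1{2m}\int_{\mathbb{T}^2}:\!|u|^{2m}\!:dx$), the same for all $p$, such that $G\in L^p(\mu)$ and $G_N\to G$ in $L^p(\mu)$ for every $1\le p<\infty$. -/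

import Mathlib

open MeasureTheory ProbabilityTheory Filter Topology
open scoped ENNReal NNReal

noncomputable section

namespace WickNLS

/-! ### The torus and Fourier modes -/

instance fact_two_pi_pos : Fact (0 < 2 * Real.pi) := ⟨Real.two_pi_pos⟩

/-- The flat torus `𝕋² = (ℝ / 2πℤ)²`. Its `volume` is the product Lebesgue measure
(of total mass `(2π)²`). -/
abbrev Torus2 : Type := AddCircle (2 * Real.pi) × AddCircle (2 * Real.pi)

/-- The exponential `x ↦ e^{i n·x}` on `𝕋²`, for a frequency `n ∈ ℤ²`. -/
def mode (n : ℤ × ℤ) (x : Torus2) : ℂ := fourier n.1 x.1 * fourier n.2 x.2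

/-- The square `|n|²` of the Euclidean length of `n ∈ ℤ²`. -/
def normSq (n : ℤ × ℤ) : ℝ := (n.1 : ℝ) ^ 2 + (n.2 : ℝ) ^ 2

/-- The Japanese bracket `⟨n⟩ = √(1 + |n|²)`. -/
def bracket (n : ℤ × ℤ) : ℝ := Real.sqrt (1 + normSq n)

/-- The finite set of frequencies `n ∈ ℤ²` with `|n| ≤ N` (Euclidean length). -/
def freqBall (N : ℕ) : Finset (ℤ × ℤ) :=
  (Finset.Icc (-(N : ℤ)) N ×ˢ Finset.Icc (-(N : ℤ)) N).filter
    fun n => n.1 ^ 2 + n.2 ^ 2 ≤ (N : ℤ) ^ 2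

/-! ### Sobolev spaces on the torus -/

/-- The Sobolev space `H^s(𝕋²)`, `s ∈ ℝ`. A periodic distribution `u` is given by its
Fourier coefficients `û : ℤ² → ℂ`, and belongs to `H^s` when
`‖u‖_{H^s}² = ∑ₙ ⟨n⟩^{2s} |û(n)|² < ∞`. -/
@[ext]
structure Sobolev (s : ℝ) where
  /-- The Fourier coefficients. -/
  coeff : ℤ × ℤ → ℂ
  memℓp' : Memℓp (fun n => ((bracket n ^ s : ℝ) : ℂ) * coeff n) 2

/-- The map `u ↦ (⟨n⟩^s û(n))ₙ` identifying `H^s` with `ℓ²(ℤ²)`; it carries the Hilbert norm. -/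
def Sobolev.toLp {s : ℝ} (u : Sobolev s) : lp (fun _ : ℤ × ℤ => ℂ) 2 :=
  ⟨fun n => ((bracket n ^ s : ℝ) : ℂ) * u.coeff n, u.memℓp'⟩

lemma bracket_pos (n : ℤ × ℤ) : 0 < bracket n := by
  unfold bracket normSq
  positivity

lemma Sobolev.toLp_injective {s : ℝ} : Function.Injective (Sobolev.toLp (s := s)) := by
  intro u v h
  ext n
  have h' : ((bracket n ^ s : ℝ) : ℂ) * u.coeff n = ((bracket n ^ s : ℝ) : ℂ) * v.coeff n :=
    congrFun (congrArg Subtype.val h) n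
  have h0 : ((bracket n ^ s : ℝ) : ℂ) ≠ 0 := by
    exact_mod_cast (Real.rpow_pos_of_pos (bracket_pos n) s).ne'
  exact mul_left_cancel₀ h0 h'

/-- The metric `dist u v = ‖u - v‖_{H^s}`. -/
instance (s : ℝ) : MetricSpace (Sobolev s) :=
  MetricSpace.induced Sobolev.toLp Sobolev.toLp_injective inferInstance

lemma Sobolev.isometry_toLp (s : ℝ) : Isometry (Sobolev.toLp (s := s)) :=
  Isometry.of_dist_eq fun _ _ => rfl

/-- The Borel `σ`-algebra of `H^s`. -/
instance (s : ℝ) : MeasurableSpace (Sobolev s) := borel _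

instance (s : ℝ) : BorelSpace (Sobolev s) := ⟨rfl⟩

/-- The zero distribution. -/
instance (s : ℝ) : Zero (Sobolev s) := ⟨⟨0, by simpa using! zero_memℓp⟩⟩

/-! ### The massive Gaussian free field -/

/-- The law of a standard complex Gaussian `g`: `Re g` and `Im g` are independent, real Gaussian
with mean `0` and variance `1/2`, so that `𝔼 g = 0` and `𝔼 |g|² = 1`. -/
def stdComplexGaussian : Measure ℂ :=
  ((gaussianReal 0 (1 / 2)).prod (gaussianReal 0 (1 / 2))).map
    fun p : ℝ × ℝ => (p.1 : ℂ) + (p.2 : ℂ) * Complex.I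

instance : IsProbabilityMeasure stdComplexGaussian :=
  Measure.isProbabilityMeasure_map (by fun_prop)

/-- The canonical probability space carrying independent standard complex Gaussian random
variables `g n`, `n ∈ ℤ²` (the coordinates of `g`). -/
def gaussianFamily : Measure (ℤ × ℤ → ℂ) :=
  Measure.infinitePi fun _ => stdComplexGaussian

instance : IsProbabilityMeasure gaussianFamily := by
  unfold gaussianFamily; infer_instance

open Classical in
/-- The random Fourier series `u = ∑ₙ (g n / √(1 + |n|²)) e^{i n·x}`, as an element of `H^s`.
(On the event where the series fails to be in `H^s`, of probability zero
when `s < 0`, it is set to `0`.) -/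
def gffField (s : ℝ) (g : ℤ × ℤ → ℂ) : Sobolev s :=
  if h : Memℓp (fun n => ((bracket n ^ s : ℝ) : ℂ) * (g n / (bracket n : ℂ))) 2 then
    ⟨fun n => g n / (bracket n : ℂ), h⟩
  else 0

/-- The massive Gaussian free field `μ` on `H^s(𝕋²)`: the law of the random Fourier series. -/
def gff (s : ℝ) : Measure (Sobolev s) := gaussianFamily.map (gffField s)

/-! Well-definedness: for `s < 0` the random series lies in `H^s` almost surely, it is a measurable
map into `H^s`, and its law is a probability measure. -/

lemma measurableSet_memℓp (s : ℝ) : MeasurableSet {g : ℤ × ℤ → ℂ |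
    Memℓp (fun n => ((bracket n ^ s : ℝ) : ℂ) * (g n / (bracket n : ℂ))) 2} := by
  have h : {g : ℤ × ℤ → ℂ |
      Memℓp (fun n => ((bracket n ^ s : ℝ) : ℂ) * (g n / (bracket n : ℂ))) 2}
      = {g | (∑' n, ‖((bracket n ^ s : ℝ) : ℂ) * (g n / (bracket n : ℂ))‖ₑ ^ 2) ≠ ∞} := by
    ext g
    simp only [Set.mem_ofPred_eq]
    rw [memℓp_gen_iff (by norm_num)]
    simp only [enorm_eq_nnnorm, ← ENNReal.coe_pow]
    rw [ENNReal.tsum_coe_ne_top_iff_summable, ← NNReal.summable_coe]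
    simp
  rw [h]
  have hm : Measurable fun g : ℤ × ℤ → ℂ =>
      ∑' n, ‖((bracket n ^ s : ℝ) : ℂ) * (g n / (bracket n : ℂ))‖ₑ ^ 2 := by
    refine Measurable.tsum fun n => ?_
    fun_prop
  exact (hm (measurableSet_singleton ∞)).compl

lemma measurable_gffField (s : ℝ) : Measurable (gffField s) := by
  classical
  have hborel : borel (Sobolev s) =
      MeasurableSpace.comap Sobolev.toLp (borel (lp (fun _ : ℤ × ℤ => ℂ) 2)) := by
    rw [(Sobolev.isometry_toLp s).isUniformInducing.isInducing.eq_induced]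
    exact borel_comap
  let _ : MeasurableSpace (lp (fun _ : ℤ × ℤ => ℂ) 2) := borel _
  have : BorelSpace (lp (fun _ : ℤ × ℤ => ℂ) 2) := ⟨rfl⟩
  have key : Measurable fun g => (gffField s g).toLp := by
    set A := {g : ℤ × ℤ → ℂ |
      Memℓp (fun n => ((bracket n ^ s : ℝ) : ℂ) * (g n / (bracket n : ℂ))) 2} with hA
    have hAm : MeasurableSet A := measurableSet_memℓp s
    let c : ℤ × ℤ → (ℤ × ℤ → ℂ) → ℂ := fun n =>
      A.indicator fun g => ((bracket n ^ s : ℝ) : ℂ) * (g n / (bracket n : ℂ))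
    have hc : ∀ n, Measurable (c n) := fun n => Measurable.indicator (by fun_prop) hAm
    have hval : ∀ g n, (gffField s g).toLp n = c n g := by
      intro g n
      by_cases hg : g ∈ A
      · simp only [c, Set.indicator_of_mem hg]
        have hg' : Memℓp (fun n => ((bracket n ^ s : ℝ) : ℂ) * (g n / (bracket n : ℂ))) 2 := hg
        simp only [gffField, dif_pos hg']
        rfl
      · simp only [c, Set.indicator_of_notMem hg]
        have hg' : ¬ Memℓp (fun n => ((bracket n ^ s : ℝ) : ℂ) * (g n / (bracket n : ℂ))) 2 := hg
        simp only [gffField, dif_neg hg']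
        exact mul_zero _
    have : Fact ((1 : ℝ≥0∞) ≤ 2) := ⟨by norm_num⟩
    refine measurable_of_tendsto_metrizable' (f := fun (F : Finset (ℤ × ℤ)) (g : ℤ × ℤ → ℂ) =>
      ∑ n ∈ F, lp.single (E := fun _ : ℤ × ℤ => ℂ) 2 n (c n g)) atTop ?_ ?_
    · intro F
      have hcont : Continuous fun a : F → ℂ =>
          ∑ n : F, lp.single (E := fun _ : ℤ × ℤ => ℂ) 2 (n : ℤ × ℤ) (a n) := by
        refine continuous_finsetSum _ fun n _ => ?_
        exact (lp.singleContinuousLinearMap ℂ (fun _ : ℤ × ℤ => ℂ) 2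
          (n : ℤ × ℤ)).continuous.comp (continuous_apply n)
      have h2 : Measurable fun (g : ℤ × ℤ → ℂ) (n : F) => c n g :=
        measurable_pi_lambda _ fun n => hc n
      have h3 := hcont.measurable.comp h2
      have h4 : (fun g : ℤ × ℤ → ℂ => ∑ n ∈ F, lp.single (E := fun _ : ℤ × ℤ => ℂ) 2 n (c n g))
          = (fun a : F → ℂ => ∑ n : F, lp.single (E := fun _ : ℤ × ℤ => ℂ) 2 (n : ℤ × ℤ) (a n)) ∘
            fun (g : ℤ × ℤ → ℂ) (n : F) => c n g := by
        funext g
        exact (Finset.sum_coe_sort F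
          fun n => lp.single (E := fun _ : ℤ × ℤ => ℂ) 2 n (c n g)).symm
      rw [h4]
      exact h3
    · rw [tendsto_pi_nhds]
      intro g
      have := lp.hasSum_single (E := fun _ : ℤ × ℤ => ℂ) (p := 2) (by norm_num)
        (gffField s g).toLp
      simp only [hval] at this
      exact this
  intro S hS
  have hS' : MeasurableSet[borel (Sobolev s)] S := hS
  rw [hborel] at hS'
  obtain ⟨T, hT, rfl⟩ := hS'
  exact key hT

lemma lintegral_stdComplexGaussian_ne_top : ∫⁻ z, ‖z‖ₑ ^ 2 ∂stdComplexGaussian ≠ ∞ := by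
  rw [stdComplexGaussian, lintegral_map (by fun_prop) (by fun_prop)]
  generalize hγ : gaussianReal 0 (1 / 2) = γ
  have hprob : IsProbabilityMeasure γ := by rw [← hγ]; infer_instance
  have h1 : MemLp (fun x : ℝ => x) 2 γ := by
    rw [← hγ]; exact memLp_id_gaussianReal 2
  have hf : MemLp (fun p : ℝ × ℝ => p.1) 2 (γ.prod γ) :=
    h1.comp_measurePreserving measurePreserving_fst
  have hg : MemLp (fun p : ℝ × ℝ => p.2) 2 (γ.prod γ) :=
    h1.comp_measurePreserving measurePreserving_snd
  have hf' : MemLp (fun p : ℝ × ℝ => (p.1 : ℂ)) 2 (γ.prod γ) := hf.ofReal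
  have hg' : MemLp (fun p : ℝ × ℝ => (p.2 : ℂ)) 2 (γ.prod γ) := hg.ofReal
  have hg2 : MemLp (fun p : ℝ × ℝ => (p.2 : ℂ) * Complex.I) 2 (γ.prod γ) :=
    hg'.mul_const Complex.I
  have h : MemLp (fun p : ℝ × ℝ => (p.1 : ℂ) + (p.2 : ℂ) * Complex.I) 2 (γ.prod γ) :=
    hf'.add hg2
  have h2 := lintegral_rpow_enorm_lt_top_of_eLpNorm_lt_top (by norm_num) (by norm_num) h.2
  simpa using h2.ne

lemma summable_bracket {r : ℝ} (hr : r < -2) : Summable fun n => bracket n ^ r := by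
  have h := (EisensteinSeries.summable_one_div_norm_rpow (k := -r) (by linarith))
  rw [← (finTwoArrowEquiv _).symm.summable_iff] at h
  refine h.of_norm_bounded_eventually ?_
  have h0 : ∀ᶠ n : ℤ × ℤ in cofinite, n ≠ 0 := by
    simp
  filter_upwards [h0] with n hn
  rw [Real.norm_of_nonneg (Real.rpow_nonneg (bracket_pos n).le _)]
  simp only [Function.comp_apply, finTwoArrowEquiv_symm_apply, neg_neg]
  have hpos : 0 < ‖![n.1, n.2]‖ := by
    rw [norm_pos_iff]
    intro h
    apply hn
    ext
    · simpa using congrFun h 0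
    · simpa using congrFun h 1
  refine Real.rpow_le_rpow_of_nonpos hpos ?_ (by linarith)
  rw [pi_norm_le_iff_of_nonneg (bracket_pos n).le]
  intro i
  unfold bracket normSq
  apply Real.le_sqrt_of_sq_le
  fin_cases i <;> simp [Int.norm_eq_abs] <;> nlinarith [sq_nonneg (n.1 : ℝ), sq_nonneg (n.2 : ℝ)]

lemma ae_memℓp {s : ℝ} (hs : s < 0) : ∀ᵐ g ∂gaussianFamily,
    Memℓp (fun n => ((bracket n ^ s : ℝ) : ℂ) * (g n / (bracket n : ℂ))) 2 := by
  have hI : ∫⁻ g, (∑' n, ‖((bracket n ^ s : ℝ) : ℂ) * (g n / (bracket n : ℂ))‖ₑ ^ 2)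
      ∂gaussianFamily ≠ ∞ := by
    rw [lintegral_tsum fun n => Measurable.aemeasurable (by fun_prop)]
    have hterm : ∀ n, ∫⁻ g, ‖((bracket n ^ s : ℝ) : ℂ) * (g n / (bracket n : ℂ))‖ₑ ^ 2
        ∂gaussianFamily
        = ENNReal.ofReal (bracket n ^ (2 * s - 2)) * ∫⁻ z, ‖z‖ₑ ^ 2 ∂stdComplexGaussian := by
      intro n
      have hb := bracket_pos n
      have hmp : MeasurePreserving (Function.eval n) gaussianFamily stdComplexGaussian :=
        measurePreserving_eval_infinitePi (fun _ : ℤ × ℤ => stdComplexGaussian) n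
      rw [← hmp.lintegral_comp (by fun_prop), ← lintegral_const_mul _ (by fun_prop)]
      congr 1
      funext g
      have e : ((bracket n ^ s : ℝ) : ℂ) * (g n / (bracket n : ℂ))
          = ((bracket n ^ (s - 1) : ℝ) : ℂ) * g n := by
        rw [Real.rpow_sub_one hb.ne']
        push_cast
        ring
      have hp : 0 ≤ bracket n ^ (s - 1) := Real.rpow_nonneg hb.le _
      rw [e, enorm_mul, mul_pow]
      congr 1
      rw [← ofReal_norm, Complex.norm_real, Real.norm_of_nonneg hp,
        ← ENNReal.ofReal_pow hp, ← Real.rpow_natCast, ← Real.rpow_mul hb.le]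
      congr 2
      push_cast
      ring
    simp only [hterm]
    rw [ENNReal.tsum_mul_right]
    refine ENNReal.mul_ne_top ?_ lintegral_stdComplexGaussian_ne_top
    exact (summable_bracket (r := 2 * s - 2) (by linarith)).tsum_ofReal_ne_top
  have hm : Measurable fun g : ℤ × ℤ → ℂ =>
      ∑' n, ‖((bracket n ^ s : ℝ) : ℂ) * (g n / (bracket n : ℂ))‖ₑ ^ 2 := by
    refine Measurable.tsum fun n => ?_
    fun_prop
  filter_upwards [ae_lt_top hm hI] with g hg
  rw [memℓp_gen_iff (by norm_num)]
  have := hg.ne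
  simp only [enorm_eq_nnnorm, ← ENNReal.coe_pow] at this
  rw [ENNReal.tsum_coe_ne_top_iff_summable, ← NNReal.summable_coe] at this
  simpa using this

lemma isProbabilityMeasure_gff (s : ℝ) : IsProbabilityMeasure (gff s) :=
  Measure.isProbabilityMeasure_map (measurable_gffField s).aemeasurable

/-! ### Wick ordering -/

/-- The Laguerre polynomial `L_m(x) = ∑_{ℓ ≤ m} (m choose ℓ) (-1)^ℓ / ℓ! x^ℓ`. -/
def laguerre (m : ℕ) (x : ℝ) : ℝ :=
  ∑ l ∈ Finset.range (m + 1), (m.choose l : ℝ) * ((-1) ^ l / (l.factorial : ℝ)) * x ^ l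

/-- `L_m(x; σ) = σ^m L_m(x / σ)`, for `σ > 0`. -/
def laguerreVar (m : ℕ) (x σ : ℝ) : ℝ := σ ^ m * laguerre m (x / σ)

/-- `σ_N = ∑_{|n| ≤ N} 1 / (1 + |n|²)`, the variance of `P_N u (x)` under `μ`. -/
def sigmaN (N : ℕ) : ℝ := ∑ n ∈ freqBall N, 1 / (1 + normSq n)

/-- The Dirichlet projection `P_N u (x) = ∑_{|n| ≤ N} û(n) e^{i n·x}`, a function on `𝕋²`. -/
def proj {s : ℝ} (N : ℕ) (u : Sobolev s) (x : Torus2) : ℂ :=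
  ∑ n ∈ freqBall N, u.coeff n * mode n x

/-- The Wick ordered monomial `:|P_N u|^{2m}: (x) = (-1)^m m! L_m(|P_N u (x)|²; σ_N)`. -/
def wickPower {s : ℝ} (m N : ℕ) (u : Sobolev s) (x : Torus2) : ℝ :=
  (-1) ^ m * (m.factorial : ℝ) * laguerreVar m (‖proj N u x‖ ^ 2) (sigmaN N)

/-- The truncated Wick ordered potential energy `G_N(u) = (1 / 2m) ∫_{𝕋²} :|P_N u|^{2m}: dx`. -/
def wickEnergy {s : ℝ} (m N : ℕ) (u : Sobolev s) : ℝ :=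
  1 / (2 * (m : ℝ)) * ∫ x : Torus2, wickPower m N u x

end WickNLS

end

noncomputable section

namespace WickNLS

open scoped ComplexConjugate

/-! ### One complex Gaussian -/

/-! Wick ordering is averaging over a complex shift. If `φ` is an independent copy of the field `P_N
u(x)`, then `:|z|^{2m}:` is the mean over `φ` of `(z + iφ)^m (z̄ + iφ̄)^m`
(`integral_shifted_pow_eq_laguerreVar`). For independent standard complex Gaussians `g` and `h`, the
variables `(g + ih)/√2` and `(ḡ + ih̄)/√2` are again independent standard complex Gaussians
(`measurePreserving_complexShift`). Hence the energy is a partial average of a homogeneous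
polynomial of degree `2m` in independent complex Gaussians, with no conjugates
(`finEnergy_eq_average`).

For such polynomials no hypercontractivity is needed. The `k`-th power has the same form, with
coefficient tensor `T^{⊗k}`, so Wick's formula for second moments bounds the moment of order `2k` by
`(2mk)! ‖T‖^{2k}` (`integral_norm_pow_tensorPoly_le`). Taking the root gives an `L^{2k}` norm of at
most `(2mk)^m ‖T‖`, and averaging does not increase it.

For `G_M - G_N`, integration in `x` keeps only tuples of frequencies with vanishing signed sum, and
the coefficients cancel unless some frequency leaves the ball of radius `N`. Convolution bounds for
`⟨n⟩^{-2}` on `ℤ²` give `‖T‖² ≤ C/N` (`exists_sum_tail_le`), whence the rate `N^{-1/2}`. General `p`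
follows by monotonicity of `L^p` norms, and the limits in the various `L^p` coincide because each is
also a limit in measure. -/

lemma stdComplexGaussian_eq_map : stdComplexGaussian =
    ((gaussianReal 0 (1 / 2)).prod (gaussianReal 0 (1 / 2))).map
      (Complex.equivRealProdCLM.symm : ℝ × ℝ →L[ℝ] ℂ) := by
  unfold stdComplexGaussian
  congr 1
  funext p
  simp [Complex.equivRealProdCLM_symm_apply]

instance isGaussian_stdComplexGaussian : IsGaussian stdComplexGaussian := by
  rw [stdComplexGaussian_eq_map]
  infer_instance

lemma memLp_stdComplexGaussian {p : ℝ≥0∞} (hp : p ≠ ∞) : MemLp (fun z : ℂ => z) p stdComplexGaussian :=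
  IsGaussian.memLp_id _ p hp

/-- A centred real Gaussian pair with equal variances is rotation invariant, and in the plane a
rotation is multiplication by a phase. -/
lemma measurePreserving_exp_mul (θ : ℝ) :
    MeasurePreserving (fun z : ℂ => Complex.exp (-θ * Complex.I) * z)
      stdComplexGaussian stdComplexGaussian := by
  refine ⟨by fun_prop, ?_⟩
  have h := IsGaussian.map_rotation_eq_self (μ := gaussianReal 0 (1 / 2)) (by simp) θ
  conv_rhs => rw [stdComplexGaussian, ← h]
  rw [stdComplexGaussian, Measure.map_map (by fun_prop) (by fun_prop),
    Measure.map_map (by fun_prop) (by fun_prop)]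
  congr 1
  funext p
  have e : Complex.exp (-θ * Complex.I) = Real.cos θ - Real.sin θ * Complex.I := by
    rw [Complex.exp_mul_I]; push_cast; simp [sub_eq_add_neg]
  simp only [Function.comp_apply, ContinuousLinearMap.rotation_apply, e, smul_eq_mul]
  push_cast
  rw [← Complex.ofReal_sin]
  linear_combination (-(Real.sin θ : ℂ) * p.2) * Complex.I_sq

lemma measurePreserving_I_mul :
    MeasurePreserving (fun z : ℂ => Complex.I * z) stdComplexGaussian stdComplexGaussian := by
  have h := measurePreserving_exp_mul (-(Real.pi / 2))
  have e : Complex.exp (-((-(Real.pi / 2) : ℝ) : ℂ) * Complex.I) = Complex.I := by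
    push_cast
    rw [neg_neg, Complex.exp_pi_div_two_mul_I]
  simpa only [e] using h

lemma measurePreserving_conj :
    MeasurePreserving (fun z : ℂ => conj z) stdComplexGaussian stdComplexGaussian := by
  refine ⟨by fun_prop, ?_⟩
  have h : MeasurePreserving (Prod.map id Neg.neg)
      ((gaussianReal 0 (1 / 2)).prod (gaussianReal 0 (1 / 2)))
      ((gaussianReal 0 (1 / 2)).prod (gaussianReal 0 (1 / 2))) :=
    (MeasurePreserving.id _).prod ⟨by fun_prop, by
      have := gaussianReal_map_neg (μ := 0) (v := 1 / 2)
      rw [neg_zero] at this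
      exact this⟩
  conv_rhs => rw [stdComplexGaussian, ← h.map_eq]
  rw [stdComplexGaussian, Measure.map_map (by fun_prop) (by fun_prop),
    Measure.map_map (by fun_prop) (by fun_prop)]
  congr 1
  funext p
  simp

lemma integral_stdComplexGaussian_eq_zero : ∫ z, z ∂stdComplexGaussian = 0 := by
  -- The phase of angle `π` is `-1`, so the mean equals its own negative.
  have h := (measurePreserving_exp_mul Real.pi).integral_comp'
    (f := MeasurableEquiv.mulLeft₀ (Complex.exp (-Real.pi * Complex.I)) (Complex.exp_ne_zero _))
    (fun z : ℂ => z)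
  simp only [MeasurableEquiv.coe_mulLeft₀] at h
  rw [neg_mul, Complex.exp_neg, Complex.exp_pi_mul_I, integral_const_mul, inv_neg, inv_one] at h
  have h2 : (2 : ℂ) * ∫ z, z ∂stdComplexGaussian = 0 := by linear_combination -h
  simpa using h2

lemma measurePreserving_half_rotation :
    MeasurePreserving (fun p : ℂ × ℂ => (((√2)⁻¹ : ℂ) * (p.1 + p.2), ((√2)⁻¹ : ℂ) * (p.2 - p.1)))
      (stdComplexGaussian.prod stdComplexGaussian)
      (stdComplexGaussian.prod stdComplexGaussian) := by
  have h := IsGaussian.map_rotation_eq_self (μ := stdComplexGaussian)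
    integral_stdComplexGaussian_eq_zero (Real.pi / 4)
  refine ⟨by fun_prop, ?_⟩
  conv_rhs => rw [← h]
  congr 1
  funext p
  have e : √2 / 2 = (√2)⁻¹ := by
    rw [div_eq_iff (by norm_num), eq_comm, inv_mul_eq_iff_eq_mul₀ (by positivity)]
    norm_num
  simp only [ContinuousLinearMap.rotation_apply, Real.cos_pi_div_four, Real.sin_pi_div_four, e,
    Complex.real_smul, Prod.mk.injEq]
  push_cast
  constructor <;> ring

/-- The density of the law is `e^{-|z|²}/π`, so the moment is a radial integral with value `Γ(a +
1)`. -/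
lemma integral_norm_pow_stdComplexGaussian (a : ℕ) :
    ∫ z : ℂ, ‖z‖ ^ (2 * a) ∂stdComplexGaussian = (a.factorial : ℝ) := by
  have hv : (1 / 2 : ℝ≥0) ≠ 0 := by norm_num
  have hmp := Complex.volume_preserving_equiv_real_prod.symm
  rw [stdComplexGaussian, gaussianReal_of_var_ne_zero _ hv,
    prod_withDensity (by fun_prop) (by fun_prop),
    integral_map (by fun_prop) (by fun_prop),
    integral_withDensity_eq_integral_toReal_smul (by fun_prop)
      (ae_of_all _ fun z => ENNReal.mul_lt_top (by simp [gaussianPDF]) (by simp [gaussianPDF]))]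
  have hG := Complex.integral_rpow_mul_exp_neg_rpow (p := 2) (q := 2 * a) (by norm_num)
    (by have : (0:ℝ) ≤ a := Nat.cast_nonneg a
        linarith)
  have hG' : (2 * (a : ℝ) + 2) / 2 = a + 1 := by ring
  rw [hG', Real.Gamma_nat_eq_factorial] at hG
  have hpi := Real.pi_pos
  have hG2 : ∫ x : ℂ, Real.pi⁻¹ * (‖x‖ ^ (2 * (a:ℝ)) * Real.exp (-‖x‖ ^ (2:ℝ))) = a.factorial := by
    rw [integral_const_mul, hG]
    field_simp
  rw [← hG2, ← hmp.integral_comp']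
  refine integral_congr_ae (ae_of_all _ fun p => ?_)
  have hn : ‖(p.1 : ℂ) + p.2 * Complex.I‖ ^ 2 = p.1 ^ 2 + p.2 ^ 2 := by
    rw [← Complex.normSq_eq_norm_sq]; simp [Complex.normSq_apply]; ring
  have hp : Complex.measurableEquivRealProd.symm p = (p.1 : ℂ) + p.2 * Complex.I := by
    apply Complex.ext <;> simp [Complex.measurableEquivRealProd]
  have hr : ∀ z : ℂ, ‖z‖ ^ (2 * (a : ℝ)) = ‖z‖ ^ (2 * a) := fun z => by
    rw [← Real.rpow_natCast]; push_cast; rfl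
  simp only [hp, hr, Real.rpow_two, hn, ENNReal.toReal_mul, toReal_gaussianPDF, smul_eq_mul,
    gaussianPDFReal]
  have hs : √(2 * Real.pi * ((1 / 2 : ℝ≥0) : ℝ)) = √Real.pi := by
    congr 1; push_cast; ring
  have hs2 : (√Real.pi)⁻¹ * (√Real.pi)⁻¹ = Real.pi⁻¹ := by
    rw [← mul_inv, Real.mul_self_sqrt hpi.le]
  have he : Real.exp (-(p.1 - 0) ^ 2 / (2 * ((1 / 2 : ℝ≥0) : ℝ))) *
      Real.exp (-(p.2 - 0) ^ 2 / (2 * ((1 / 2 : ℝ≥0) : ℝ))) = Real.exp (-(p.1 ^ 2 + p.2 ^ 2)) := by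
    rw [← Real.exp_add]; congr 1; push_cast; ring
  rw [hs, ← he, ← hs2]
  ring

/-- The moments of a standard complex Gaussian. -/
lemma integral_pow_mul_conj_pow (a b : ℕ) :
    ∫ z : ℂ, z ^ a * conj z ^ b ∂stdComplexGaussian = if a = b then (a.factorial : ℂ) else 0 := by
  split_ifs with hab
  · subst hab
    rw [← Complex.ofReal_natCast, ← integral_norm_pow_stdComplexGaussian, ← integral_complex_ofReal]
    refine integral_congr_ae (ae_of_all _ fun z => ?_)
    simp only
    rw [← mul_pow, Complex.mul_conj, Complex.normSq_eq_norm_sq, pow_mul]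
    push_cast
    rfl
  -- Rotating by one radian multiplies the integrand by `e^{i(b-a)}`. This is not `1` when `a ≠ b`,
  -- because `π` is irrational, so one angle serves all exponents.
  · set c : ℂ := Complex.exp (-(1 : ℝ) * Complex.I) with hc
    have hc0 : c ≠ 0 := Complex.exp_ne_zero _
    have h := (measurePreserving_exp_mul 1).integral_comp'
      (f := MeasurableEquiv.mulLeft₀ c hc0) (fun z : ℂ => z ^ a * conj z ^ b)
    have h1 : ∀ z : ℂ, (c * z) ^ a * conj (c * z) ^ b = (c ^ a * conj c ^ b) *
        (z ^ a * conj z ^ b) := fun z => by rw [map_mul]; ring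
    simp only [MeasurableEquiv.coe_mulLeft₀, h1, integral_const_mul] at h
    have h2 : c ^ a * conj c ^ b ≠ 1 := by
      rw [hc, ← Complex.exp_conj, ← Complex.exp_nat_mul, ← Complex.exp_nat_mul, ← Complex.exp_add]
      intro h3
      rw [Complex.exp_eq_one_iff] at h3
      obtain ⟨n, hn⟩ := h3
      simp only [map_mul, map_neg, Complex.conj_ofReal, Complex.conj_I] at hn
      have h4 : ((b : ℝ) - a : ℝ) = n * (2 * Real.pi) := by
        have h5 := congrArg Complex.im hn
        simp at h5
        linarith
      have hn0 : n ≠ 0 := by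
        rintro rfl
        simp at h4
        apply hab
        have : (b : ℝ) = a := by linarith
        exact_mod_cast this.symm
      refine irrational_pi.ne_rational ((b : ℤ) - a) (n * 2) ?_
      push_cast
      rw [h4]
      have : (n : ℝ) ≠ 0 := by exact_mod_cast hn0
      field_simp
    have h6 : (c ^ a * conj c ^ b - 1) * ∫ z : ℂ, z ^ a * conj z ^ b ∂stdComplexGaussian = 0 := by
      linear_combination h
    exact (mul_eq_zero.mp h6).resolve_left (sub_ne_zero.mpr h2)

/-! ### Functions with moments of all orders -/

/-- A complex random variable all of whose absolute moments are finite. -/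
def HasAllMoments {Ω : Type*} [MeasurableSpace Ω] (f : Ω → ℂ) (P : Measure Ω) : Prop :=
  ∀ p : ℝ≥0∞, p ≠ ∞ → MemLp f p P

namespace HasAllMoments

variable {Ω Ω' : Type*} [MeasurableSpace Ω] [MeasurableSpace Ω'] {P : Measure Ω} {Q : Measure Ω'}
  {f g : Ω → ℂ}

lemma integrable (hf : HasAllMoments f P) : Integrable f P :=
  memLp_one_iff_integrable.mp (hf 1 (by norm_num))

lemma const [IsFiniteMeasure P] (c : ℂ) : HasAllMoments (fun _ => c) P :=
  fun _ _ => memLp_const c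

lemma add (hf : HasAllMoments f P) (hg : HasAllMoments g P) :
    HasAllMoments (fun x => f x + g x) P :=
  fun p hp => (hf p hp).add (hg p hp)

lemma mul (hf : HasAllMoments f P) (hg : HasAllMoments g P) :
    HasAllMoments (fun x => f x * g x) P := by
  intro p hp
  have hp2 : 2 * p ≠ ∞ := ENNReal.mul_ne_top (by norm_num) hp
  have : ENNReal.HolderTriple (2 * p) (2 * p) p := by
    constructor
    rw [ENNReal.mul_inv (by norm_num) (by norm_num), ← add_mul, ENNReal.inv_two_add_inv_two,
      one_mul]
  exact (hg (2 * p) hp2).mul (hf (2 * p) hp2)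

lemma map_conj (hf : HasAllMoments f P) : HasAllMoments (fun x => conj (f x)) P :=
  fun p hp => (hf p hp).star

lemma comp_measurePreserving {φ : Ω' → Ω} (hf : HasAllMoments f P)
    (hφ : MeasurePreserving φ Q P) : HasAllMoments (fun x => f (φ x)) Q :=
  fun p hp => (hf p hp).comp_measurePreserving hφ

lemma sum [IsFiniteMeasure P] {κ : Type*} (s : Finset κ) {F : κ → Ω → ℂ}
    (hF : ∀ i, HasAllMoments (F i) P) : HasAllMoments (fun x => ∑ i ∈ s, F i x) P :=
  fun p hp => memLp_finsetSum s fun i _ => hF i p hp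

lemma prod [IsFiniteMeasure P] {κ : Type*} (s : Finset κ) {F : κ → Ω → ℂ}
    (hF : ∀ i, HasAllMoments (F i) P) : HasAllMoments (fun x => ∏ i ∈ s, F i x) P := by
  classical
  induction s using Finset.induction_on with
  | empty => simpa using const (P := P) 1
  | insert a s ha ih =>
    simp only [Finset.prod_insert ha]
    exact (hF a).mul ih

lemma pow [IsFiniteMeasure P] (hf : HasAllMoments f P) (k : ℕ) :
    HasAllMoments (fun x => f x ^ k) P := by
  simpa using prod (P := P) (Finset.range k) (fun _ => hf)

end HasAllMoments

/-! ### Finite families of independent complex Gaussians -/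

/-- The law of a finite family of independent standard complex Gaussians. -/
def gaussPi (ι : Type*) [Fintype ι] : Measure (ι → ℂ) :=
  Measure.pi fun _ => stdComplexGaussian

instance (ι : Type*) [Fintype ι] : IsProbabilityMeasure (gaussPi ι) := by
  unfold gaussPi; infer_instance

/-- The homogeneous polynomial `∑ᵢ Tᵢ ∏ₗ z_{i l}` with coefficient tensor `T`. -/
def tensorPoly {ι J : Type*} [Fintype ι] [Fintype J] [DecidableEq J] (T : (J → ι) → ℂ)
    (z : ι → ℂ) : ℂ :=
  ∑ i, T i * ∏ l, z (i l)

/-! ### Wick's formula and moments of homogeneous polynomials -/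

section Wick

variable {ι J : Type*} [Fintype ι] [Fintype J]

lemma hasAllMoments_eval (a : ι) : HasAllMoments (fun z : ι → ℂ => z a) (gaussPi ι) := fun _ hp =>
  (memLp_stdComplexGaussian hp).comp_measurePreserving (measurePreserving_eval _ a)

lemma hasAllMoments_tensorPoly [DecidableEq J] (T : (J → ι) → ℂ) :
    HasAllMoments (tensorPoly T) (gaussPi ι) :=
  HasAllMoments.sum _ fun i => (HasAllMoments.const _).mul
    (HasAllMoments.prod _ fun l => hasAllMoments_eval (i l))

lemma prod_comp_eq_prod_pow [DecidableEq ι] (i : J → ι) (z : ι → ℂ) :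
    ∏ l, z (i l) = ∏ a, z a ^ Fintype.card {l // i l = a} := by
  rw [← Finset.prod_fiberwise' Finset.univ i z]
  refine Finset.prod_congr rfl fun a _ => ?_
  rw [Finset.prod_const, Fintype.card_subtype]

lemma integral_prod_mul_conj_prod [DecidableEq ι] {J' : Type*} [Fintype J'] (i : J → ι)
    (j : J' → ι) :
    ∫ z, (∏ l, z (i l)) * conj (∏ l, z (j l)) ∂(gaussPi ι) =
      ∏ a, if Fintype.card {l // i l = a} = Fintype.card {l // j l = a} then
        ((Fintype.card {l // i l = a}).factorial : ℂ) else 0 := by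
  simp only [prod_comp_eq_prod_pow, map_prod, map_pow, ← Finset.prod_mul_distrib]
  rw [gaussPi, integral_fintype_prod_eq_prod
    (fun a z => z ^ Fintype.card {l // i l = a} * conj z ^ Fintype.card {l // j l = a})]
  simp only [integral_pow_mul_conj_pow]

/-- Products of different degrees are orthogonal. -/
lemma integral_prod_mul_conj_prod_of_card_ne {J' : Type*} [Fintype J'] (i : J → ι)
    (j : J' → ι) (h : Fintype.card J ≠ Fintype.card J') :
    ∫ z, (∏ l, z (i l)) * conj (∏ l, z (j l)) ∂(gaussPi ι) = 0 := by
  classical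
  rw [integral_prod_mul_conj_prod]
  have : ∃ a, Fintype.card {l // i l = a} ≠ Fintype.card {l // j l = a} := by
    by_contra! hc
    -- Equal fibre sizes would glue to a bijection between the two index types.
    exact h (Fintype.card_congr (Equiv.ofFiberEquiv fun a => Fintype.equivOfCardEq (hc a)))
  obtain ⟨a, ha⟩ := this
  exact Finset.prod_eq_zero (Finset.mem_univ a) (if_neg ha)

/-- **Wick's formula** for complex Gaussians. -/
lemma integral_prod_mul_conj_prod_eq_sum_perm [DecidableEq ι] [DecidableEq J] (i j : J → ι) :
    ∫ z, (∏ l, z (i l)) * conj (∏ l, z (j l)) ∂(gaussPi ι) =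
      ∑ σ : Equiv.Perm J, if i ∘ σ = j then (1 : ℂ) else 0 := by
  rw [integral_prod_mul_conj_prod]
  by_cases hc : ∀ a, Fintype.card {l // i l = a} = Fintype.card {l // j l = a}
  · simp only [hc, if_true]
    -- One matching `τ` with `i ∘ τ = j` is fixed; all others are `τ g` with `g` in the stabilizer
    -- of `j`, whose order is the product of the factorials of the fibre sizes.
    set τ : J ≃ J := Equiv.ofFiberEquiv (f := j) (g := i)
      fun a => Fintype.equivOfCardEq (hc a).symm with hτ
    have hij : ∀ l, i (τ l) = j l := fun l => Equiv.ofFiberEquiv_map _ l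
    rw [← Nat.cast_prod, ← DomMulAct.stabilizer_card j, Finset.sum_boole,
      ← Fintype.card_subtype]
    congr 1
    refine Fintype.card_congr ((Equiv.mulLeft (τ : Equiv.Perm J)).subtypeEquiv fun g => ?_)
    simp only [Equiv.coe_mulLeft, funext_iff, Function.comp_apply, Equiv.Perm.mul_apply, hij]
  · push Not at hc
    obtain ⟨a, ha⟩ := hc
    rw [Finset.prod_eq_zero (Finset.mem_univ a) (if_neg ha), eq_comm]
    refine Finset.sum_eq_zero fun σ _ => if_neg ?_
    rintro rfl
    exact ha (Fintype.card_congr (σ.subtypeEquiv fun l => by simp).symm)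

lemma integral_tensorPoly_mul_conj [DecidableEq J] (T : (J → ι) → ℂ) :
    ∫ z, tensorPoly T z * conj (tensorPoly T z) ∂(gaussPi ι) =
      ∑ σ : Equiv.Perm J, ∑ i, T i * conj (T (i ∘ σ)) := by
  classical
  have e : ∀ z : ι → ℂ, tensorPoly T z * conj (tensorPoly T z) = ∑ i, ∑ j, (T i * conj (T j)) *
      ((∏ l, z (i l)) * conj (∏ l, z (j l))) := by
    intro z
    rw [tensorPoly, map_sum, Finset.sum_mul_sum]
    refine Finset.sum_congr rfl fun i _ => Finset.sum_congr rfl fun j _ => ?_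
    rw [map_mul]; ring
  have hm : ∀ i : J → ι, HasAllMoments (fun z : ι → ℂ => ∏ l, z (i l)) (gaussPi ι) := fun i =>
    HasAllMoments.prod _ fun l => hasAllMoments_eval (i l)
  have hI : ∀ i j : J → ι, Integrable (fun z : ι → ℂ => (T i * conj (T j)) *
      ((∏ l, z (i l)) * conj (∏ l, z (j l)))) (gaussPi ι) := fun i j =>
    ((hm i).mul (hm j).map_conj).integrable.const_mul _
  simp only [e]
  rw [integral_finsetSum _ fun i _ => integrable_finsetSum _ fun j _ => hI i j]
  simp only [integral_finsetSum _ fun j _ => hI _ j, integral_const_mul,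
    integral_prod_mul_conj_prod_eq_sum_perm, Finset.mul_sum, mul_ite, mul_one, mul_zero]
  simp only [Finset.sum_comm (s := Finset.univ (α := J → ι)) (t := Finset.univ (α := Equiv.Perm J)),
    Finset.sum_ite_eq, Finset.mem_univ, if_true]

/-- Wick's formula pairs `T` with each of its permutations. Permuting slots preserves the `ℓ²` norm,
so `2ab ≤ a² + b²` bounds each pairing by `‖T‖²`; no symmetry of `T` is required. -/
lemma integral_norm_sq_tensorPoly_le [DecidableEq J] (T : (J → ι) → ℂ) :
    ∫ z, ‖tensorPoly T z‖ ^ 2 ∂(gaussPi ι) ≤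
      (Fintype.card J).factorial * ∑ i, ‖T i‖ ^ 2 := by
  have h := integral_tensorPoly_mul_conj T
  simp only [Complex.mul_conj, Complex.normSq_eq_norm_sq, integral_complex_ofReal] at h
  have h0 : 0 ≤ ∫ z, ‖tensorPoly T z‖ ^ 2 ∂(gaussPi ι) := integral_nonneg fun z => by positivity
  have h1 := congrArg norm h
  rw [Complex.norm_real, Real.norm_of_nonneg h0] at h1
  rw [h1, ← Fintype.card_perm, ← nsmul_eq_mul, ← Finset.card_univ, ← Finset.sum_const]
  refine (norm_sum_le _ _).trans (Finset.sum_le_sum fun σ _ => (norm_sum_le _ _).trans ?_)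
  have h2 : ∑ i, ‖T (i ∘ σ)‖ ^ 2 = ∑ i, ‖T i‖ ^ 2 :=
    (Equiv.arrowCongr σ.symm (Equiv.refl ι)).sum_comp fun i => ‖T i‖ ^ 2
  calc ∑ i, ‖T i * conj (T (i ∘ σ))‖ ≤ ∑ i, (‖T i‖ ^ 2 + ‖T (i ∘ σ)‖ ^ 2) / 2 := by
        refine Finset.sum_le_sum fun i _ => ?_
        rw [norm_mul, RCLike.norm_conj]
        nlinarith [sq_nonneg (‖T i‖ - ‖T (i ∘ σ)‖)]
    _ = ∑ i, ‖T i‖ ^ 2 := by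
        rw [← Finset.sum_div, Finset.sum_add_distrib, h2]; ring

/-- Moments of homogeneous polynomials in independent complex Gaussians. -/
lemma integral_norm_pow_tensorPoly_le [DecidableEq J] (T : (J → ι) → ℂ) (k : ℕ) :
    ∫ z, ‖tensorPoly T z‖ ^ (2 * k) ∂(gaussPi ι) ≤
      (k * Fintype.card J).factorial * (∑ i, ‖T i‖ ^ 2) ^ k := by
  -- The `k`-th power is the polynomial of the tensor power of `T`, with slots `Fin k × J`; its
  -- second moment is the moment sought.
  let e : (Fin k × J → ι) ≃ (Fin k → J → ι) := Equiv.curry (Fin k) J ι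
  have h1 : ∀ z, tensorPoly T z ^ k = tensorPoly (fun i => ∏ r, T (e i r)) z := by
    intro z
    rw [tensorPoly, Fintype.sum_pow, ← e.sum_comp, tensorPoly]
    refine Finset.sum_congr rfl fun i _ => ?_
    rw [Finset.prod_mul_distrib, Fintype.prod_prod_type]
    rfl
  have h2 : ∑ i, ‖∏ r, T (e i r)‖ ^ 2 = (∑ i, ‖T i‖ ^ 2) ^ k := by
    rw [Fintype.sum_pow, ← e.sum_comp]
    simp only [norm_prod, Finset.prod_pow]
  have h3 := integral_norm_sq_tensorPoly_le fun i => ∏ r, T (e i r)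
  rw [h2] at h3
  simp only [← h1, norm_pow, ← pow_mul, Fintype.card_prod, Fintype.card_fin, mul_comm k 2] at h3
  exact h3

end Wick

/-! ### Fourier modes -/

lemma mode_add (n k : ℤ × ℤ) (x : Torus2) : mode (n + k) x = mode n x * mode k x := by
  simp only [mode, Prod.fst_add, Prod.snd_add, fourier_add]
  ring

lemma mode_zero (x : Torus2) : mode 0 x = 1 := by simp [mode]

lemma mode_neg (n : ℤ × ℤ) (x : Torus2) : mode (-n) x = conj (mode n x) := by
  simp only [mode, Prod.fst_neg, Prod.snd_neg, fourier_neg, map_mul]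

lemma mode_sum {κ : Type*} (s : Finset κ) (n : κ → ℤ × ℤ) (x : Torus2) :
    mode (∑ i ∈ s, n i) x = ∏ i ∈ s, mode (n i) x := by
  classical
  induction s using Finset.induction_on with
  | empty => simp [mode_zero]
  | insert a s ha ih => rw [Finset.sum_insert ha, Finset.prod_insert ha, mode_add, ih]

lemma norm_mode (n : ℤ × ℤ) (x : Torus2) : ‖mode n x‖ = 1 := by
  simp only [mode, fourier_apply, norm_mul, Circle.norm_coe, mul_one]

lemma continuous_mode (n : ℤ × ℤ) : Continuous (mode n) := by
  unfold mode
  fun_prop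

lemma integral_fourier (n : ℤ) :
    ∫ x : AddCircle (2 * Real.pi), (fourier n x : ℂ) = if n = 0 then (2 * Real.pi : ℂ) else 0 := by
  split_ifs with h
  · subst h
    simp only [fourier_zero, integral_const, mul_one, Measure.real,
      AddCircle.measure_univ, ENNReal.toReal_ofReal Real.two_pi_pos.le, Complex.real_smul]
    push_cast
    ring
  -- Translation by half a period of the mode changes its sign.
  · exact integral_eq_zero_of_add_right_eq_neg
      (fourier_add_half_inv_index h Real.two_pi_pos)

lemma integral_mode (n : ℤ × ℤ) :
    ∫ x, mode n x = if n = 0 then ((2 * Real.pi) ^ 2 : ℂ) else 0 := by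
  have h : ∫ x, mode n x = (∫ x : AddCircle (2 * Real.pi), (fourier n.1 x : ℂ)) *
      ∫ x : AddCircle (2 * Real.pi), (fourier n.2 x : ℂ) :=
    integral_prod_mul (μ := (volume : Measure (AddCircle (2 * Real.pi))))
      (ν := (volume : Measure (AddCircle (2 * Real.pi))))
      (fun x => (fourier n.1 x : ℂ)) (fun x => (fourier n.2 x : ℂ))
  rw [h, integral_fourier, integral_fourier]
  simp only [Prod.ext_iff, Prod.fst_zero, Prod.snd_zero]
  by_cases h1 : n.1 = 0 <;> by_cases h2 : n.2 = 0 <;> simp [h1, h2]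
  ring

lemma integrable_mode (n : ℤ × ℤ) : Integrable (mode n) :=
  (continuous_mode n).integrable_of_hasCompactSupport (HasCompactSupport.of_compactSpace _)

/-! ### Wick ordering as a complex shift -/

section Shift

variable {ι : Type*} [Fintype ι]

/-- The vector `((g + i h) / √2, (ḡ + i h̄) / √2)`. -/
def complexShift (p : (ι → ℂ) × (ι → ℂ)) : ι ⊕ ι → ℂ :=
  Sum.elim (fun a => ((√2)⁻¹ : ℂ) * (p.1 a + Complex.I * p.2 a))
    (fun a => ((√2)⁻¹ : ℂ) * (conj (p.1 a) + Complex.I * conj (p.2 a)))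

/-- Since `ih` has the law of `h`, a rotation by `π/4` makes `(g + ih)/√2` and `(g - ih)/√2`
independent and standard; the second coordinate is the conjugate of the latter. -/
lemma measurePreserving_complexShift_site :
    MeasurePreserving (fun p : ℂ × ℂ => (((√2)⁻¹ : ℂ) * (p.1 + Complex.I * p.2),
        ((√2)⁻¹ : ℂ) * (conj p.1 + Complex.I * conj p.2)))
      (stdComplexGaussian.prod stdComplexGaussian)
      (stdComplexGaussian.prod stdComplexGaussian) := by
  have h1 := (MeasurePreserving.id stdComplexGaussian).prod measurePreserving_I_mul
  have h2 := (MeasurePreserving.id stdComplexGaussian).prod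
    -- Multiplying by `i` twice turns the rotated coordinate `ih - g` into `g - ih` before
    -- conjugation.
    (measurePreserving_conj.comp (measurePreserving_I_mul.comp measurePreserving_I_mul))
  have h := h2.comp (measurePreserving_half_rotation.comp h1)
  convert h using 1
  funext p
  have hI : Complex.I * Complex.I = -1 := Complex.I_mul_I
  simp only [Function.comp_apply, Prod.map, id, Prod.mk.injEq, true_and, ← mul_assoc, hI]
  simp
  ring

lemma measurePreserving_complexShift :
    MeasurePreserving (complexShift (ι := ι)) ((gaussPi ι).prod (gaussPi ι)) (gaussPi (ι ⊕ ι)) := by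
  have h1 := (measurePreserving_arrowProdEquivProdArrow ℂ ℂ ι (fun _ => stdComplexGaussian)
    (fun _ => stdComplexGaussian))
  have h2 := measurePreserving_pi (fun _ : ι => stdComplexGaussian.prod stdComplexGaussian)
    (fun _ : ι => stdComplexGaussian.prod stdComplexGaussian)
    (fun _ => measurePreserving_complexShift_site)
  have h3 := measurePreserving_sumPiEquivProdPi_symm (X := fun _ : ι ⊕ ι => ℂ)
    (fun _ : ι ⊕ ι => stdComplexGaussian)
  have h := h3.comp (h1.comp (h2.comp h1.symm))
  convert! h using 1

variable (c : ι → ℂ)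

lemma hasAllMoments_linear : HasAllMoments (fun h : ι → ℂ => ∑ a, c a * h a) (gaussPi ι) :=
  HasAllMoments.sum _ fun a => (HasAllMoments.const _).mul (hasAllMoments_eval a)

lemma linear_pow_eq_tensorPoly (k : ℕ) (h : ι → ℂ) :
    (∑ a, c a * h a) ^ k = tensorPoly (fun i : Fin k → ι => ∏ l, c (i l)) h := by
  rw [Fintype.sum_pow, tensorPoly]
  simp only [Finset.prod_mul_distrib]

/-- Moments of a linear combination of independent complex Gaussians. -/
lemma integral_linear_pow_mul_conj_pow (a b : ℕ) :
    ∫ h, (∑ n, c n * h n) ^ a * conj (∑ n, c n * h n) ^ b ∂(gaussPi ι) =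
      if a = b then (a.factorial : ℂ) * ((∑ n, ‖c n‖ ^ 2 : ℝ) : ℂ) ^ a else 0 := by
  simp only [← map_pow, linear_pow_eq_tensorPoly]
  split_ifs with hab
  · subst hab
    rw [integral_tensorPoly_mul_conj]
    have h1 : ∀ σ : Equiv.Perm (Fin a), ∑ i : Fin a → ι, (∏ l, c (i l)) *
        conj (∏ l, c ((i ∘ σ) l)) = ((∑ n, ‖c n‖ ^ 2 : ℝ) : ℂ) ^ a := by
      intro σ
      push_cast
      rw [Fintype.sum_pow]
      refine Finset.sum_congr rfl fun i _ => ?_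
      rw [show ∏ l, c ((i ∘ σ) l) = ∏ l, c (i l) from Equiv.prod_comp σ fun l => c (i l),
        map_prod, ← Finset.prod_mul_distrib]
      refine Finset.prod_congr rfl fun l _ => ?_
      rw [Complex.mul_conj, Complex.normSq_eq_norm_sq]
      push_cast
      rfl
    simp only [h1, Finset.sum_const, Finset.card_univ, Fintype.card_perm, Fintype.card_fin,
      nsmul_eq_mul]
  · have hm : ∀ (k : ℕ) (i : Fin k → ι),
        HasAllMoments (fun z : ι → ℂ => ∏ l, z (i l)) (gaussPi ι) := fun k i =>
      HasAllMoments.prod _ fun l => hasAllMoments_eval (i l)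
    have e : ∀ z : ι → ℂ, tensorPoly (fun i : Fin a → ι => ∏ l, c (i l)) z *
        conj (tensorPoly (fun i : Fin b → ι => ∏ l, c (i l)) z) =
        ∑ i : Fin a → ι, ∑ j : Fin b → ι, ((∏ l, c (i l)) * conj (∏ l, c (j l))) *
          ((∏ l, z (i l)) * conj (∏ l, z (j l))) := by
      intro z
      rw [tensorPoly, tensorPoly, map_sum, Finset.sum_mul_sum]
      refine Finset.sum_congr rfl fun i _ => Finset.sum_congr rfl fun j _ => ?_
      rw [map_mul]; ring
    have hI : ∀ (i : Fin a → ι) (j : Fin b → ι), Integrable (fun z : ι → ℂ =>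
        ((∏ l, c (i l)) * conj (∏ l, c (j l))) * ((∏ l, z (i l)) * conj (∏ l, z (j l))))
        (gaussPi ι) := fun i j => ((hm a i).mul (hm b j).map_conj).integrable.const_mul _
    simp only [e]
    rw [integral_finsetSum _ fun i _ => integrable_finsetSum _ fun j _ => hI i j]
    refine Finset.sum_eq_zero fun i _ => ?_
    rw [integral_finsetSum _ fun j _ => hI i j]
    refine Finset.sum_eq_zero fun j _ => ?_
    rw [integral_const_mul, integral_prod_mul_conj_prod_of_card_ne _ _ (by simpa using hab),
      mul_zero]

/-- The Wick power `(-1)^m m! L_m(|z|²; σ)` is the average of `(z + iφ)^m (z̄ + iφ̄)^m` over a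
complex Gaussian `φ` of variance `σ`. -/
lemma integral_shifted_pow_eq_laguerreVar (m : ℕ) (z : ℂ) (hc : 0 < ∑ n, ‖c n‖ ^ 2) :
    ∫ h, (z + Complex.I * ∑ n, c n * h n) ^ m *
      (conj z + Complex.I * conj (∑ n, c n * h n)) ^ m ∂(gaussPi ι) =
      (((-1) ^ m * (m.factorial : ℝ) * laguerreVar m (‖z‖ ^ 2) (∑ n, ‖c n‖ ^ 2) : ℝ) : ℂ) := by
  set σ := ∑ n, ‖c n‖ ^ 2 with hσ
  have e : ∀ h : ι → ℂ, (z + Complex.I * ∑ n, c n * h n) ^ m *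
      (conj z + Complex.I * conj (∑ n, c n * h n)) ^ m =
      ∑ a ∈ Finset.range (m + 1), ∑ b ∈ Finset.range (m + 1),
        (z ^ a * conj z ^ b * (m.choose a * m.choose b) * Complex.I ^ (m - a + (m - b))) *
          ((∑ n, c n * h n) ^ (m - a) * conj (∑ n, c n * h n) ^ (m - b)) := by
    intro h
    rw [add_pow, add_pow, Finset.sum_mul_sum]
    refine Finset.sum_congr rfl fun a _ => Finset.sum_congr rfl fun b _ => ?_
    rw [mul_pow, mul_pow, pow_add]; ring
  have hI : ∀ a b : ℕ, Integrable (fun h : ι → ℂ =>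
      (z ^ a * conj z ^ b * (m.choose a * m.choose b) * Complex.I ^ (m - a + (m - b))) *
          ((∑ n, c n * h n) ^ (m - a) * conj (∑ n, c n * h n) ^ (m - b))) (gaussPi ι) :=
    fun a b => (((hasAllMoments_linear c).pow _).mul
      ((hasAllMoments_linear c).map_conj.pow _)).integrable.const_mul _
  simp only [e]
  rw [integral_finsetSum _ fun i _ => integrable_finsetSum (Finset.range (m + 1)) fun j _ => hI i j]
  simp only [integral_finsetSum (Finset.range (m + 1)) fun j _ => hI _ j, integral_const_mul,
    integral_linear_pow_mul_conj_pow, ← hσ]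
  clear_value σ
  rw [laguerreVar, laguerre, Finset.mul_sum, Finset.mul_sum, Complex.ofReal_sum]
  refine Finset.sum_congr rfl fun a ha => ?_
  have ham : a ≤ m := Nat.lt_succ_iff.mp (Finset.mem_range.mp ha)
  -- Phase invariance of `φ` kills the terms with different powers of `φ` and `φ̄`; the diagonal
  -- ones are the Laguerre terms.
  rw [Finset.sum_eq_single a]
  · rw [if_pos rfl, ← two_mul, pow_mul, Complex.I_sq]
    have h1 : σ ^ m * (‖z‖ ^ 2 / σ) ^ a = (‖z‖ ^ 2) ^ a * σ ^ (m - a) := by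
      rw [div_pow]
      field_simp
      rw [mul_assoc, ← pow_add, Nat.add_sub_cancel' ham, mul_comm]
    have h2 : (m.factorial : ℝ) / a.factorial = m.choose a * (m - a).factorial := by
      rw [div_eq_iff (by positivity), ← Nat.choose_mul_factorial_mul_factorial ham]
      push_cast; ring
    have h3 : (-1 : ℝ) ^ m * (-1) ^ a = (-1) ^ (m - a) := by
      conv_lhs => rw [← Nat.sub_add_cancel ham]
      rw [pow_add, mul_assoc, ← mul_pow]
      simp
    have h4 : z ^ a * conj z ^ a = (((‖z‖ ^ 2) ^ a : ℝ) : ℂ) := by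
      rw [← mul_pow, Complex.mul_conj, Complex.normSq_eq_norm_sq]
      push_cast; rfl
    have h5 : (-1 : ℝ) ^ m * (m.factorial : ℝ) *
        (σ ^ m * ((m.choose a : ℝ) * ((-1) ^ a / (a.factorial : ℝ)) * (‖z‖ ^ 2 / σ) ^ a)) =
        (‖z‖ ^ 2) ^ a * (m.choose a * m.choose a) * (-1) ^ (m - a) *
          ((m - a).factorial * σ ^ (m - a)) := by
      calc _ = ((-1 : ℝ) ^ m * (-1) ^ a) * ((m.factorial : ℝ) / a.factorial) * m.choose a *
            (σ ^ m * (‖z‖ ^ 2 / σ) ^ a) := by ring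
        _ = _ := by rw [h1, h2, h3]; ring
    rw [h5, h4]
    push_cast
    ring
  · intro b hb hba
    have hbm : b ≤ m := Nat.lt_succ_iff.mp (Finset.mem_range.mp hb)
    rw [if_neg (by omega), mul_zero]
  · intro h; exact absurd ha h

end Shift

/-! ### Moments of partial averages -/

/-- On each fibre the `L¹` norm is at most the `L^p` norm, as `Q` is a probability measure; Tonelli
then assembles the fibres. -/
lemma eLpNorm_integral_right_le {X Y : Type*} [MeasurableSpace X] [MeasurableSpace Y]
    {P : Measure X} {Q : Measure Y} [SFinite P] [IsProbabilityMeasure Q] {D : X × Y → ℂ}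
    (hD : Measurable D) {p : ℝ≥0∞} (hp : 1 ≤ p) (hp' : p ≠ ∞) :
    eLpNorm (fun x => ∫ y, D (x, y) ∂Q) p P ≤ eLpNorm D p (P.prod Q) := by
  have hp0 : p ≠ 0 := (zero_lt_one.trans_le hp).ne'
  have hpos : 0 < p.toReal := ENNReal.toReal_pos hp0 hp'
  rw [eLpNorm_eq_lintegral_rpow_enorm_toReal hp0 hp', eLpNorm_eq_lintegral_rpow_enorm_toReal hp0 hp',
    lintegral_prod _ (by fun_prop)]
  gcongr with x
  have h1 : ‖∫ y, D (x, y) ∂Q‖ₑ ≤ eLpNorm (fun y => D (x, y)) p Q := by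
    refine (enorm_integral_le_lintegral_enorm _).trans ?_
    rw [← eLpNorm_one_eq_lintegral_enorm]
    exact eLpNorm_le_eLpNorm_of_exponent_le hp
      (hD.comp measurable_prodMk_left).aestronglyMeasurable
  rw [eLpNorm_eq_lintegral_rpow_enorm_toReal hp0 hp'] at h1
  calc ‖∫ y, D (x, y) ∂Q‖ₑ ^ p.toReal
      ≤ ((∫⁻ y, ‖D (x, y)‖ₑ ^ p.toReal ∂Q) ^ (1 / p.toReal)) ^ p.toReal := by gcongr
    _ = ∫⁻ y, ‖D (x, y)‖ₑ ^ p.toReal ∂Q := by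
        rw [← ENNReal.rpow_mul, one_div_mul_cancel hpos.ne', ENNReal.rpow_one]

/-! ### `L^{2k}` bounds for polynomials of the complex shift -/

section Tensor

variable {ι J : Type*} [Fintype ι] [Fintype J] [DecidableEq J]

lemma measurable_tensorPoly (T : (J → ι) → ℂ) : Measurable (tensorPoly T) := by
  unfold tensorPoly
  fun_prop

lemma measurable_complexShift : Measurable (complexShift (ι := ι)) :=
  measurePreserving_complexShift.measurable

lemma tensorPoly_sub (T U : (J → ι) → ℂ) (z : ι → ℂ) :
    tensorPoly (fun i => T i - U i) z = tensorPoly T z - tensorPoly U z := by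
  simp only [tensorPoly, sub_mul, Finset.sum_sub_distrib]

/-- The factor `(2mk)^m` is the `2k`-th root of `(2mk)^{2mk}`, a crude upper bound for the factorial
`(2mk)!` in the moment estimate. -/
lemma eLpNorm_tensorPoly_le (T : (J → ι) → ℂ) {m k : ℕ} (hJ : Fintype.card J = 2 * m)
    (hk : 1 ≤ k) :
    eLpNorm (tensorPoly T) ((2 * k : ℕ) : ℝ≥0∞) (gaussPi ι) ≤
      ENNReal.ofReal ((2 * m * k : ℝ) ^ m * √(∑ i, ‖T i‖ ^ 2)) := by
  have hk0 : 2 * k ≠ 0 := by omega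
  have hB : 0 ≤ (2 * m * k : ℝ) ^ m * √(∑ i, ‖T i‖ ^ 2) := by positivity
  rw [(hasAllMoments_tensorPoly T _ (ENNReal.natCast_ne_top _)).eLpNorm_eq_integral_rpow_norm
    (by exact_mod_cast hk0) (ENNReal.natCast_ne_top _)]
  refine ENNReal.ofReal_le_ofReal ?_
  simp only [ENNReal.toReal_natCast, Real.rpow_natCast]
  rw [← Real.pow_rpow_inv_natCast hB hk0]
  refine Real.rpow_le_rpow (integral_nonneg fun z => by positivity) ?_ (by positivity)
  refine (integral_norm_pow_tensorPoly_le T k).trans ?_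
  rw [mul_pow, pow_mul (√_), Real.sq_sqrt (by positivity), hJ]
  refine mul_le_mul_of_nonneg_right ?_ (by positivity)
  have h := Nat.factorial_le_pow (k * (2 * m))
  calc ((k * (2 * m)).factorial : ℝ) ≤ ((k * (2 * m)) ^ (k * (2 * m)) : ℕ) := by exact_mod_cast h
    _ = ((2 * m * k : ℝ) ^ m) ^ (2 * k) := by
      rw [← pow_mul]; push_cast
      congr 1 <;> ring

/-- Moment bound for the average of a homogeneous polynomial of the complex shift. -/
lemma eLpNorm_average_tensorPoly_le (T : (J → ι ⊕ ι) → ℂ) {m k : ℕ}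
    (hJ : Fintype.card J = 2 * m) (hk : 1 ≤ k) :
    eLpNorm (fun g => ∫ h, tensorPoly T (complexShift (g, h)) ∂(gaussPi ι))
        ((2 * k : ℕ) : ℝ≥0∞) (gaussPi ι) ≤
      ENNReal.ofReal ((2 * m * k : ℝ) ^ m * √(∑ i, ‖T i‖ ^ 2)) := by
  have h1 : (1 : ℝ≥0∞) ≤ ((2 * k : ℕ) : ℝ≥0∞) := by exact_mod_cast (by omega : 1 ≤ 2 * k)
  refine (eLpNorm_integral_right_le (D := fun p => tensorPoly T (complexShift p))
    ((measurable_tensorPoly T).comp measurable_complexShift) h1 (ENNReal.natCast_ne_top _)).trans ?_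
  have h2 := eLpNorm_comp_measurePreserving (p := ((2 * k : ℕ) : ℝ≥0∞))
    (measurable_tensorPoly T).aestronglyMeasurable (measurePreserving_complexShift (ι := ι))
  rw [Function.comp_def] at h2
  rw [h2]
  exact eLpNorm_tensorPoly_le T hJ hk

lemma hasAllMoments_complexShift (g : ι → ℂ) (s : ι ⊕ ι) :
    HasAllMoments (fun h => complexShift (g, h) s) (gaussPi ι) := by
  rcases s with a | a
  · exact (HasAllMoments.const _).mul ((HasAllMoments.const _).add
      ((HasAllMoments.const _).mul (hasAllMoments_eval a)))
  · have h : HasAllMoments (fun h : ι → ℂ => conj (h a)) (gaussPi ι) :=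
      (hasAllMoments_eval a).map_conj
    exact (HasAllMoments.const (√2 : ℂ)⁻¹).mul
      ((HasAllMoments.const (conj (g a))).add ((HasAllMoments.const Complex.I).mul h))

lemma integrable_tensorPoly_complexShift (T : (J → ι ⊕ ι) → ℂ) (g : ι → ℂ) :
    Integrable (fun h => tensorPoly T (complexShift (g, h))) (gaussPi ι) := by
  refine HasAllMoments.integrable (HasAllMoments.sum _ fun i =>
    (HasAllMoments.const _).mul (HasAllMoments.prod _ fun l =>
      hasAllMoments_complexShift g (i l)))

end Tensor

/-! ### The Wick ordered energy of a finite random Fourier series -/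

section Energy

variable {ι : Type*} [Fintype ι] (ν : ι → ℤ × ℤ) (β : ι → ℝ) (m : ℕ)

/-- The trigonometric polynomial with frequencies `ν a` and Fourier coefficients `β a * g a`. -/
def finField (g : ι → ℂ) (x : Torus2) : ℂ := ∑ a, β a * mode (ν a) x * g a

/-- The integral of the Wick power of order `m` of a finite random Fourier series. -/
def finEnergy (g : ι → ℂ) : ℝ :=
  ∫ x : Torus2, (-1) ^ m * (m.factorial : ℝ) *
    laguerreVar m (‖finField ν β g x‖ ^ 2) (∑ a, β a ^ 2)

variable {m}

/-- The frequency of the product of `m` modes and `m` conjugate modes. -/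
def freqSum (k : Fin m ⊕ Fin m → ι) : ℤ × ℤ :=
  ∑ l, ν (k (.inl l)) - ∑ l, ν (k (.inr l))

/-- Sends the first `m` slots to the first copy of `ι`, the others to the second copy. -/
def slotEmb (k : Fin m ⊕ Fin m → ι) : Fin m ⊕ Fin m → ι ⊕ ι :=
  Sum.map (fun l => k (.inl l)) (fun l => k (.inr l))

lemma slotEmb_injective {ι : Type*} : Function.Injective (slotEmb (ι := ι) (m := m)) := by
  intro k k' h
  funext j
  rcases j with l | l
  · exact Sum.inl_injective (congrFun h (.inl l))
  · exact Sum.inr_injective (congrFun h (.inr l))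

/-- The coefficients of the energy as a polynomial in the complex shift. -/
def energyCoeff (k : Fin m ⊕ Fin m → ι) : ℂ :=
  2 ^ m * (∏ j, (β (k j) : ℂ)) * if freqSum ν k = 0 then ((2 * Real.pi) ^ 2 : ℂ) else 0

variable (m) in
/-- The tensor of coefficients of the energy. -/
def energyTensor : (Fin m ⊕ Fin m → ι ⊕ ι) → ℂ :=
  Function.extend slotEmb (energyCoeff ν β) 0

lemma tensorPoly_energyTensor (z : ι ⊕ ι → ℂ) : tensorPoly (energyTensor ν β m) z =
    ∑ k : Fin m ⊕ Fin m → ι, energyCoeff ν β k * ∏ j, z (slotEmb k j) := by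
  rw [tensorPoly, eq_comm]
  refine Fintype.sum_of_injective slotEmb slotEmb_injective _ _ (fun i hi => ?_) fun k => ?_
  · rw [energyTensor, Function.extend_apply' _ _ _ (by simpa using hi)]
    simp
  · rw [energyTensor, slotEmb_injective.extend_apply]

lemma sum_norm_sq_energyTensor_sub (β' : ι → ℝ) :
    ∑ i, ‖energyTensor ν β m i - energyTensor ν β' m i‖ ^ 2 =
      ∑ k : Fin m ⊕ Fin m → ι, ‖energyCoeff ν β k - energyCoeff ν β' k‖ ^ 2 := by
  rw [eq_comm]
  refine Fintype.sum_of_injective slotEmb slotEmb_injective _ _ (fun i hi => ?_) fun k => ?_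
  · rw [energyTensor, energyTensor, Function.extend_apply' _ _ _ (by simpa using hi),
      Function.extend_apply' _ _ _ (by simpa using hi)]
    simp
  · rw [energyTensor, energyTensor, slotEmb_injective.extend_apply, slotEmb_injective.extend_apply]

/-- Both shifted fields are `√2` times linear forms in the complex shift, which accounts for `2 ^
m`. Expanding the product isolates the dependence on `x` in one mode per tuple. -/
lemma shifted_field_pow (g h : ι → ℂ) (x : Torus2) :
    (finField ν β g x + Complex.I * finField ν β h x) ^ m *
      (conj (finField ν β g x) + Complex.I * conj (finField ν β h x)) ^ m =
      ∑ k : Fin m ⊕ Fin m → ι, 2 ^ m * (∏ j, (β (k j) : ℂ)) *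
        (∏ j, complexShift (g, h) (slotEmb k j)) * mode (freqSum ν k) x := by
  have hs : (√2 : ℂ) * (√2 : ℂ)⁻¹ = 1 := mul_inv_cancel₀ (by simp)
  have hs2 : (√2 : ℂ) ^ m * (√2 : ℂ) ^ m = 2 ^ m := by
    rw [← mul_pow, ← Complex.ofReal_mul, Real.mul_self_sqrt (by norm_num)]; norm_num
  -- The first `m` slots carry the field, the last `m` its conjugate counterpart, so the two powers
  -- become one product over slots.
  let y : Fin m ⊕ Fin m → ι → ℂ := Sum.elim
    (fun _ a => β a * mode (ν a) x * complexShift (g, h) (.inl a))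
    (fun _ a => β a * conj (mode (ν a) x) * complexShift (g, h) (.inr a))
  have h1 : (finField ν β g x + Complex.I * finField ν β h x) =
      √2 * ∑ a, β a * mode (ν a) x * complexShift (g, h) (.inl a) := by
    simp only [finField, complexShift, Sum.elim_inl, Finset.mul_sum, ← Finset.sum_add_distrib]
    refine Finset.sum_congr rfl fun a _ => ?_
    linear_combination (-(β a : ℂ) * mode (ν a) x * (g a + Complex.I * h a)) * hs
  have h2 : (conj (finField ν β g x) + Complex.I * conj (finField ν β h x)) =
      √2 * ∑ a, β a * conj (mode (ν a) x) * complexShift (g, h) (.inr a) := by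
    simp only [finField, complexShift, Sum.elim_inr, Finset.mul_sum, map_sum, map_mul,
      Complex.conj_ofReal, ← Finset.sum_add_distrib]
    refine Finset.sum_congr rfl fun a _ => ?_
    linear_combination (-(β a : ℂ) * conj (mode (ν a) x) *
      (conj (g a) + Complex.I * conj (h a))) * hs
  have h3 : (∑ a, β a * mode (ν a) x * complexShift (g, h) (.inl a)) ^ m *
      (∑ a, β a * conj (mode (ν a) x) * complexShift (g, h) (.inr a)) ^ m = ∏ j, ∑ a, y j a := by
    rw [Fintype.prod_sum_type]
    simp [y]
  rw [h1, h2, mul_pow, mul_pow, mul_mul_mul_comm, hs2, h3, Finset.prod_univ_sum,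
    Fintype.piFinset_univ, Finset.mul_sum]
  refine Finset.sum_congr rfl fun k _ => ?_
  simp only [Fintype.prod_sum_type, y, Sum.elim_inl, Sum.elim_inr, Finset.prod_mul_distrib,
    freqSum, sub_eq_add_neg, mode_add, mode_neg, mode_sum, map_prod, slotEmb, Sum.map_inl,
    Sum.map_inr]
  ring

/-- The Wick ordered energy is a partial average of a homogeneous polynomial in independent
complex Gaussians. -/
lemma finEnergy_eq_average (hβ : 0 < ∑ a, β a ^ 2) (g : ι → ℂ) :
    (finEnergy ν β m g : ℂ) =
      ∫ h, tensorPoly (energyTensor ν β m) (complexShift (g, h)) ∂(gaussPi ι) := by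
  -- Modes are unimodular, so the variance of the field is the same at every point.
  have hc : ∀ x, ∑ a, ‖(β a : ℂ) * mode (ν a) x‖ ^ 2 = ∑ a, β a ^ 2 := fun x => by
    simp [norm_mode]
  have hI : ∀ k : Fin m ⊕ Fin m → ι,
      Integrable (fun h => ∏ j, complexShift (g, h) (slotEmb k j)) (gaussPi ι) := by
    intro k
    exact HasAllMoments.integrable (HasAllMoments.prod _ fun j => hasAllMoments_complexShift g _)
  have h1 : ∀ x, (((-1) ^ m * (m.factorial : ℝ) *
      laguerreVar m (‖finField ν β g x‖ ^ 2) (∑ a, β a ^ 2) : ℝ) : ℂ) =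
      ∑ k : Fin m ⊕ Fin m → ι, (2 ^ m * (∏ j, (β (k j) : ℂ)) *
        ∫ h, ∏ j, complexShift (g, h) (slotEmb k j) ∂(gaussPi ι)) * mode (freqSum ν k) x := by
    intro x
    have h2 := integral_shifted_pow_eq_laguerreVar (fun a => (β a : ℂ) * mode (ν a) x) m
      (finField ν β g x) (by rw [hc]; exact hβ)
    rw [hc] at h2
    rw [← h2]
    have h3 := shifted_field_pow ν β (m := m) g
    simp only [finField] at h3 ⊢
    simp only [h3]
    rw [integral_finsetSum _ fun k _ => ((hI k).const_mul _).mul_const _]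
    simp only [integral_mul_const, integral_const_mul]
  rw [finEnergy, ← integral_complex_ofReal]
  simp only [h1, tensorPoly_energyTensor]
  rw [integral_finsetSum _ fun k _ => (integrable_mode _).const_mul _,
    integral_finsetSum _ fun k _ => (hI k).const_mul _]
  refine Finset.sum_congr rfl fun k _ => ?_
  rw [integral_const_mul, integral_const_mul, integral_mode, energyCoeff]
  ring

/-- Moment bound for differences of Wick ordered energies. -/
lemma eLpNorm_finEnergy_sub_le (β' : ι → ℝ) (hβ : 0 < ∑ a, β a ^ 2) (hβ' : 0 < ∑ a, β' a ^ 2)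
    {k : ℕ} (hk : 1 ≤ k) :
    eLpNorm (fun g => finEnergy ν β m g - finEnergy ν β' m g) ((2 * k : ℕ) : ℝ≥0∞) (gaussPi ι) ≤
      ENNReal.ofReal ((2 * m * k : ℝ) ^ m *
        √(∑ k : Fin m ⊕ Fin m → ι, ‖energyCoeff ν β k - energyCoeff ν β' k‖ ^ 2)) := by
  rw [← sum_norm_sq_energyTensor_sub]
  refine le_trans (le_of_eq ?_) (eLpNorm_average_tensorPoly_le
    (fun i => energyTensor ν β m i - energyTensor ν β' m i) (by simp [two_mul]) hk)
  refine eLpNorm_congr_norm_ae (ae_of_all _ fun g => ?_)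
  simp only [tensorPoly_sub]
  rw [integral_sub (integrable_tensorPoly_complexShift _ g)
    (integrable_tensorPoly_complexShift _ g), ← finEnergy_eq_average ν β hβ,
    ← finEnergy_eq_average ν β' hβ', ← Complex.ofReal_sub, Complex.norm_real]

/-- Wick ordered energies have moments of all orders. -/
lemma eLpNorm_finEnergy_lt_top (hβ : 0 < ∑ a, β a ^ 2) {k : ℕ} (hk : 1 ≤ k) :
    eLpNorm (finEnergy ν β m) ((2 * k : ℕ) : ℝ≥0∞) (gaussPi ι) < ∞ := by
  refine lt_of_le_of_lt (le_of_eq ?_) ((eLpNorm_average_tensorPoly_le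
    (energyTensor ν β m) (m := m) (by simp [two_mul]) hk).trans_lt ENNReal.ofReal_lt_top)
  refine eLpNorm_congr_norm_ae (ae_of_all _ fun g => ?_)
  rw [← finEnergy_eq_average ν β hβ, Complex.norm_real]

end Energy

/-! ### Lattice sums -/

lemma normSq_nonneg (n : ℤ × ℤ) : 0 ≤ normSq n := by unfold normSq; positivity

lemma one_le_bracket (n : ℤ × ℤ) : 1 ≤ bracket n := by
  rw [bracket, Real.one_le_sqrt]
  linarith [normSq_nonneg n]

lemma bracket_sq (n : ℤ × ℤ) : bracket n ^ 2 = 1 + normSq n :=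
  Real.sq_sqrt (by linarith [normSq_nonneg n])

lemma bracket_neg (n : ℤ × ℤ) : bracket (-n) = bracket n := by
  simp [bracket, normSq]

lemma bracket_add_le (a b : ℤ × ℤ) : bracket (a + b) ≤ bracket a + bracket b := by
  have ha := bracket_pos a
  have hb := bracket_pos b
  refine Real.sqrt_le_iff.mpr ⟨by positivity, ?_⟩
  have h1 := bracket_sq a
  have h2 := bracket_sq b
  have h3 : (a.1 * b.1 + a.2 * b.2 : ℝ) ≤ bracket a * bracket b := by
    refine (le_abs_self _).trans (abs_le_of_sq_le_sq ?_ (by positivity))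
    rw [mul_pow, h1, h2]
    unfold normSq
    nlinarith [sq_nonneg (a.1 * b.2 - a.2 * b.1 : ℝ), sq_nonneg (a.1 : ℝ), sq_nonneg (a.2 : ℝ),
      sq_nonneg (b.1 : ℝ), sq_nonneg (b.2 : ℝ)]
  have h4 : normSq (a + b) = normSq a + normSq b + 2 * (a.1 * b.1 + a.2 * b.2) := by
    simp only [normSq, Prod.fst_add, Prod.snd_add]
    push_cast
    ring
  rw [h4]
  nlinarith

lemma le_bracket_of_notMem_freqBall {N : ℕ} {n : ℤ × ℤ} (hn : n ∉ freqBall N) :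
    (N : ℝ) ≤ bracket n := by
  by_contra! h
  apply hn
  have h1 : (1 : ℝ) + normSq n < N ^ 2 := by
    rw [← bracket_sq]
    exact pow_lt_pow_left₀ h (bracket_pos n).le two_ne_zero
  have h2 : n.1 ^ 2 + n.2 ^ 2 ≤ (N : ℤ) ^ 2 := by
    have : ((n.1 ^ 2 + n.2 ^ 2 : ℤ) : ℝ) ≤ ((N : ℤ) ^ 2 : ℤ) := by
      push_cast
      unfold normSq at h1
      linarith
    exact_mod_cast this
  have h3 : |n.1| ≤ N := abs_le_of_sq_le_sq (by nlinarith [sq_nonneg n.2]) (by positivity)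
  have h4 : |n.2| ≤ N := abs_le_of_sq_le_sq (by nlinarith [sq_nonneg n.1]) (by positivity)
  simp only [freqBall, Finset.mem_filter, Finset.mem_product, Finset.mem_Icc]
  exact ⟨⟨abs_le.mp h3, abs_le.mp h4⟩, h2⟩

/-- The weight `⟨n⟩^r`, with values in `[0, ∞]`. -/
def weight (r : ℝ) (n : ℤ × ℤ) : ℝ≥0∞ := ENNReal.ofReal (bracket n ^ r)

lemma weight_neg (r : ℝ) (n : ℤ × ℤ) : weight r (-n) = weight r n := by
  rw [weight, weight, bracket_neg]

lemma weight_mul (r s : ℝ) (n : ℤ × ℤ) : weight r n * weight s n = weight (r + s) n := by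
  rw [weight, weight, weight, ← ENNReal.ofReal_mul (Real.rpow_nonneg (bracket_pos n).le _),
    Real.rpow_add (bracket_pos n)]

lemma weight_mono {r s : ℝ} (h : r ≤ s) (n : ℤ × ℤ) : weight r n ≤ weight s n :=
  ENNReal.ofReal_le_ofReal (Real.rpow_le_rpow_of_exponent_le (one_le_bracket n) h)

lemma tsum_weight_ne_top {r : ℝ} (hr : r < -2) : ∑' n, weight r n ≠ ∞ :=
  (summable_bracket hr).tsum_ofReal_ne_top

/-- The larger of `x` and `y` is at least `z / 2`, so `s` powers of it can be traded for `2^s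
z^{-s}`. Its remaining exponent, `s - 2` or `s - r`, is nonpositive, so the smaller variable may
replace it. -/
lemma rpow_mul_rpow_le {r s x y z : ℝ} (hs : 0 ≤ s) (hsr : s ≤ r) (hs2 : s ≤ 2) (hx : 0 < x)
    (hy : 0 < y) (hz : 0 < z) (h : z ≤ x + y) :
    x ^ (-2 : ℝ) * y ^ (-r) ≤ 2 ^ s * z ^ (-s) * (x ^ (s - r - 2) + y ^ (s - r - 2)) := by
  have key : ∀ u v : ℝ, 0 < u → u ≤ v → z ≤ u + v → 1 ≤ 2 ^ s * z ^ (-s) * v ^ s := by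
    intro u v hu huv hz'
    have hv : 0 < v := hu.trans_le huv
    have h1 : z ^ s ≤ (2 * v) ^ s := Real.rpow_le_rpow hz.le (by linarith) hs
    rw [Real.mul_rpow (by norm_num) hv.le] at h1
    rw [Real.rpow_neg hz.le]
    have h2 : 0 < z ^ s := Real.rpow_pos_of_pos hz s
    field_simp
    linarith
  have hzs : 0 < 2 ^ s * z ^ (-s) := by positivity
  rcases le_total y x with hyx | hxy
  · have h1 := key y x hy hyx (by linarith)
    calc x ^ (-2 : ℝ) * y ^ (-r) ≤ (2 ^ s * z ^ (-s) * x ^ s) * (x ^ (-2 : ℝ) * y ^ (-r)) :=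
          le_mul_of_one_le_left (by positivity) h1
      _ = 2 ^ s * z ^ (-s) * (x ^ (s - 2) * y ^ (-r)) := by
          rw [sub_eq_add_neg, Real.rpow_add hx]; ring
      _ ≤ 2 ^ s * z ^ (-s) * (y ^ (s - 2) * y ^ (-r)) := by
          gcongr ?_ * (?_ * _)
          exact Real.rpow_le_rpow_of_nonpos hy hyx (by linarith)
      _ = 2 ^ s * z ^ (-s) * y ^ (s - r - 2) := by
          rw [← Real.rpow_add hy]; ring_nf
      _ ≤ _ := by gcongr; linarith [Real.rpow_pos_of_pos hx (s - r - 2)]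
  · have h1 := key x y hx hxy h
    calc x ^ (-2 : ℝ) * y ^ (-r) ≤ (2 ^ s * z ^ (-s) * y ^ s) * (x ^ (-2 : ℝ) * y ^ (-r)) :=
          le_mul_of_one_le_left (by positivity) h1
      _ = 2 ^ s * z ^ (-s) * (x ^ (-2 : ℝ) * y ^ (s - r)) := by
          rw [sub_eq_add_neg, Real.rpow_add hy]; ring
      _ ≤ 2 ^ s * z ^ (-s) * (x ^ (-2 : ℝ) * x ^ (s - r)) := by
          gcongr ?_ * (_ * ?_)
          exact Real.rpow_le_rpow_of_nonpos hx hxy (by linarith)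
      _ = 2 ^ s * z ^ (-s) * x ^ (s - r - 2) := by
          rw [← Real.rpow_add hx]; ring_nf
      _ ≤ _ := by gcongr; linarith [Real.rpow_pos_of_pos hy (s - r - 2)]

/-- The strict loss `s < r` puts the leftover exponent `s - r - 2` below `-2`, the summability
threshold on `ℤ²`. -/
lemma exists_tsum_weight_mul_weight_le {r s : ℝ} (hs : 0 ≤ s) (hsr : s < r) (hs2 : s ≤ 2) :
    ∃ C : ℝ≥0∞, C ≠ ∞ ∧
      ∀ n, ∑' k, weight (-2) k * weight (-r) (n - k) ≤ C * weight (-s) n := by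
  have hfin : ∑' n, weight (s - r - 2) n ≠ ∞ := tsum_weight_ne_top (by linarith)
  refine ⟨ENNReal.ofReal (2 ^ s) * (∑' n, weight (s - r - 2) n + ∑' n, weight (s - r - 2) n),
    ENNReal.mul_ne_top ENNReal.ofReal_ne_top (ENNReal.add_ne_top.mpr ⟨hfin, hfin⟩), fun n => ?_⟩
  have h1 : ∀ k, weight (-2) k * weight (-r) (n - k) ≤ ENNReal.ofReal (2 ^ s) * weight (-s) n *
      (weight (s - r - 2) k + weight (s - r - 2) (n - k)) := by
    intro k
    have hk := bracket_pos k
    have hnk := bracket_pos (n - k)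
    have hn := bracket_pos n
    simp only [weight]
    rw [← ENNReal.ofReal_mul (by positivity), ← ENNReal.ofReal_mul (by positivity),
      ← ENNReal.ofReal_add (by positivity) (by positivity), ← ENNReal.ofReal_mul (by positivity)]
    refine ENNReal.ofReal_le_ofReal (rpow_mul_rpow_le hs hsr.le hs2 hk hnk hn ?_)
    have := bracket_add_le k (n - k)
    rwa [add_sub_cancel] at this
  calc _ ≤ ∑' k, ENNReal.ofReal (2 ^ s) * weight (-s) n *
      (weight (s - r - 2) k + weight (s - r - 2) (n - k)) := ENNReal.tsum_le_tsum h1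
    _ = _ := by
      rw [ENNReal.tsum_mul_left, ENNReal.tsum_add,
        show ∑' k, weight (s - r - 2) (n - k) = ∑' k, weight (s - r - 2) k from
          (Equiv.subLeft n).tsum_eq (weight (s - r - 2))]
      ring

/-- The sum of `∏ ⟨kⱼ⟩⁻²` over all `d`-tuples of frequencies with sum `n`. -/
def convSum (d : ℕ) (n : ℤ × ℤ) : ℝ≥0∞ :=
  ∑' k : Fin d → ℤ × ℤ, if ∑ j, k j = n then ∏ j, weight (-2) (k j) else 0

/-- Splitting off slot `j` leaves the other slots to sum to `n - k`. The factor `f` lets a tail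
condition be imposed on any chosen slot. -/
lemma tsum_mul_convSum {d : ℕ} (j : Fin (d + 1)) (f : ℤ × ℤ → ℝ≥0∞) (n : ℤ × ℤ) :
    ∑' k : Fin (d + 1) → ℤ × ℤ, f (k j) * (if ∑ i, k i = n then ∏ i, weight (-2) (k i) else 0) =
      ∑' k, f k * weight (-2) k * convSum d (n - k) := by
  rw [← (Fin.insertNthEquiv (fun _ => ℤ × ℤ) j).tsum_eq, ENNReal.tsum_prod']
  refine tsum_congr fun k => ?_
  rw [convSum, ← ENNReal.tsum_mul_left]
  refine tsum_congr fun k' => ?_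
  simp only [Fin.insertNthEquiv_apply, Fin.insertNth_apply_same, Fin.sum_univ_succAbove _ j,
    Fin.prod_univ_succAbove _ j, Fin.insertNth_apply_succAbove, eq_sub_iff_add_eq',
    mul_ite, mul_zero, mul_assoc]

lemma convSum_succ (d : ℕ) (n : ℤ × ℤ) :
    convSum (d + 1) n = ∑' k, weight (-2) k * convSum d (n - k) := by
  have h := tsum_mul_convSum (0 : Fin (d + 1)) (fun _ => 1) n
  simp only [one_mul] at h
  exact h

lemma convSum_zero (n : ℤ × ℤ) : convSum 0 n = if n = 0 then 1 else 0 := by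
  simp [convSum, eq_comm]

lemma convSum_one (n : ℤ × ℤ) : convSum 1 n = weight (-2) n := by
  rw [convSum_succ, tsum_eq_single n]
  · simp [convSum_zero]
  · intro k hk
    rw [convSum_zero, if_neg (sub_ne_zero.mpr hk.symm), mul_zero]

lemma exists_convSum_le (d : ℕ) : ∀ r : ℝ, 0 ≤ r → r < 2 → ∃ C : ℝ≥0∞, C ≠ ∞ ∧
    ∀ n, convSum (d + 1) n ≤ C * weight (-r) n := by
  induction d with
  | zero =>
    intro r _ hr2
    refine ⟨1, by norm_num, fun n => ?_⟩
    rw [convSum_one, one_mul]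
    exact weight_mono (by linarith) n
  | succ d ih =>
    intro r hr hr2
    -- Each convolution costs some decay; the midpoint of `r` and `2` leaves room for that loss
    -- while staying below `2`.
    obtain ⟨C, hC, h⟩ := ih ((r + 2) / 2) (by linarith) (by linarith)
    obtain ⟨C', hC', h'⟩ := exists_tsum_weight_mul_weight_le (r := (r + 2) / 2) (s := r) hr
      (by linarith) hr2.le
    refine ⟨C * C', ENNReal.mul_ne_top hC hC', fun n => ?_⟩
    rw [convSum_succ, mul_assoc]
    calc ∑' k, weight (-2) k * convSum (d + 1) (n - k)
        ≤ ∑' k, C * (weight (-2) k * weight (-((r + 2) / 2)) (n - k)) := by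
          refine ENNReal.tsum_le_tsum fun k => ?_
          rw [mul_left_comm]
          gcongr
          exact h _
      _ ≤ C * (C' * weight (-r) n) := by
          rw [ENNReal.tsum_mul_left]
          gcongr
          exact h' n

/-- Tuples with vanishing sum and one frequency outside the ball of radius `N`. -/
lemma exists_tsum_tail_le (d : ℕ) : ∃ C : ℝ≥0∞, C ≠ ∞ ∧ ∀ N : ℕ, 1 ≤ N →
    ∑' k : Fin (d + 2) → ℤ × ℤ, (if ∑ j, k j = 0 ∧ ∃ j, k j ∉ freqBall N then
      ∏ j, weight (-2) (k j) else 0) ≤ C * ENNReal.ofReal (1 / N) := by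
  -- With decay `3/2` from the other slots, the distinguished frequency has total decay `7/2 = 1 +
  -- 5/2`: one power yields `1 / N` and the remaining `5/2 > 2` is summable.
  obtain ⟨C, hC, h⟩ := exists_convSum_le d (3 / 2) (by norm_num) (by norm_num)
  refine ⟨(d + 2 : ℕ) * (C * ∑' n, weight (-(5 / 2)) n),
    ENNReal.mul_ne_top (ENNReal.natCast_ne_top _)
      (ENNReal.mul_ne_top hC (tsum_weight_ne_top (by norm_num))), fun N hN => ?_⟩
  have hN0 : (0 : ℝ) < N := by exact_mod_cast hN
  set f : ℤ × ℤ → ℝ≥0∞ := fun n => if n ∉ freqBall N then 1 else 0 with hf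
  -- Union bound over the slot whose frequency leaves the ball.
  have h1 : ∀ k : Fin (d + 2) → ℤ × ℤ, (if ∑ j, k j = 0 ∧ ∃ j, k j ∉ freqBall N then
      ∏ j, weight (-2) (k j) else 0) ≤ ∑ j, f (k j) *
        (if ∑ i, k i = 0 then ∏ i, weight (-2) (k i) else 0) := by
    intro k
    split_ifs with hk h0
    · obtain ⟨h0, j, hj⟩ := hk
      refine le_trans ?_ (Finset.single_le_sum (fun _ _ => zero_le) (Finset.mem_univ j))
      simp [hf, hj]
    · exact absurd hk.1 h0
    · exact zero_le
    · exact zero_le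
  have h2 : ∀ n, f n * weight (-2) n * convSum (d + 1) (0 - n) ≤
      C * ENNReal.ofReal (1 / N) * weight (-(5 / 2)) n := by
    intro n
    by_cases hn : n ∈ freqBall N
    · simp [hf, hn]
    · simp only [hf, hn, not_false_eq_true, if_true, one_mul]
      have h3 : weight (-1) n ≤ ENNReal.ofReal (1 / N) := by
        refine ENNReal.ofReal_le_ofReal ?_
        rw [Real.rpow_neg_one, ← one_div]
        exact one_div_le_one_div_of_le hN0 (le_bracket_of_notMem_freqBall hn)
      calc weight (-2) n * convSum (d + 1) (0 - n) ≤ weight (-2) n * (C * weight (-(3 / 2)) n) := by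
            gcongr
            refine (h _).trans (le_of_eq ?_)
            rw [zero_sub, weight_neg]
        _ = C * weight (-1) n * weight (-(5 / 2)) n := by
            rw [mul_assoc, weight_mul, mul_left_comm, weight_mul]
            norm_num
        _ ≤ _ := by gcongr
  calc _ ≤ ∑' k : Fin (d + 2) → ℤ × ℤ, ∑ j, f (k j) *
        (if ∑ i, k i = 0 then ∏ i, weight (-2) (k i) else 0) := ENNReal.tsum_le_tsum h1
    _ = ∑ j : Fin (d + 2), ∑' n, f n * weight (-2) n * convSum (d + 1) (0 - n) := by
        rw [Summable.tsum_finsetSum fun _ _ => ENNReal.summable]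
        exact Finset.sum_congr rfl fun j _ => tsum_mul_convSum j f 0
    _ ≤ ∑ j : Fin (d + 2), C * ENNReal.ofReal (1 / N) * ∑' n, weight (-(5 / 2)) n := by
        refine Finset.sum_le_sum fun j _ => ?_
        rw [← ENNReal.tsum_mul_left]
        exact ENNReal.tsum_le_tsum h2
    _ = _ := by
        rw [Finset.sum_const, Finset.card_univ, Fintype.card_fin, nsmul_eq_mul]
        ring

lemma ofReal_one_div_one_add_normSq (n : ℤ × ℤ) :
    ENNReal.ofReal (1 / (1 + normSq n)) = weight (-2) n := by
  rw [weight, ← bracket_sq, Real.rpow_neg (bracket_pos n).le, Real.rpow_two, one_div]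

lemma exists_sum_tail_le {m : ℕ} (hm : 1 ≤ m) : ∃ C : ℝ, 0 ≤ C ∧ ∀ N : ℕ, 1 ≤ N →
    ∀ (ι : Type) [Fintype ι] (ν : ι → ℤ × ℤ), Function.Injective ν →
      ∑ k : Fin m ⊕ Fin m → ι, (if freqSum ν k = 0 ∧ ∃ j, ν (k j) ∉ freqBall N then
        ∏ j, 1 / (1 + normSq (ν (k j))) else 0) ≤ C * (1 / N) := by
  obtain ⟨d, hd⟩ : ∃ d, m + m = d + 2 := ⟨m + m - 2, by omega⟩
  obtain ⟨C, hC, h⟩ := exists_tsum_tail_le d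
  refine ⟨C.toReal, ENNReal.toReal_nonneg, fun N hN ι _ ν hν => ?_⟩
  have hpos : ∀ n : ℤ × ℤ, 0 ≤ 1 / (1 + normSq n) := fun n => by
    have := normSq_nonneg n
    positivity
  let e : Fin m ⊕ Fin m ≃ Fin (d + 2) := finSumFinEquiv.trans (finCongr hd)
  -- Negating the conjugate slots turns the signed sum into a plain sum and affects neither weights
  -- nor balls. Injectivity then bounds the finite sum by the full lattice sum, uniformly in `ι`.
  let φ : (Fin m ⊕ Fin m → ι) → Fin (d + 2) → ℤ × ℤ := fun k j =>
    Sum.elim (fun l => ν (k (.inl l))) (fun l => -ν (k (.inr l))) (e.symm j)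
  have hφ : Function.Injective φ := by
    intro k k' hk
    funext j
    have hj := congrFun hk (e j)
    simp only [φ, Equiv.symm_apply_apply] at hj
    rcases j with l | l
    · exact hν hj
    · exact hν (neg_injective hj)
  have hsum : ∀ k, ∑ j, φ k j = freqSum ν k := by
    intro k
    rw [← e.sum_comp]
    simp [φ, freqSum, Fintype.sum_sum_type, sub_eq_add_neg]
  have hball : ∀ n : ℤ × ℤ, -n ∈ freqBall N ↔ n ∈ freqBall N := by
    intro n
    simp only [freqBall, Finset.mem_filter, Finset.mem_product, Finset.mem_Icc, Prod.fst_neg,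
      Prod.snd_neg, neg_sq]
    constructor <;> rintro ⟨⟨⟨_, _⟩, _, _⟩, h3⟩ <;> refine ⟨⟨⟨?_, ?_⟩, ?_, ?_⟩, h3⟩ <;> linarith
  have hex : ∀ k, (∃ j, φ k j ∉ freqBall N) ↔ ∃ j, ν (k j) ∉ freqBall N := by
    intro k
    refine e.symm.exists_congr fun j => ?_
    simp only [φ]
    rcases e.symm j with l | l <;> simp [hball]
  have hprod : ∀ k, ∏ j, weight (-2) (φ k j) =
      ENNReal.ofReal (∏ j, 1 / (1 + normSq (ν (k j)))) := by
    intro k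
    rw [← e.prod_comp, ENNReal.ofReal_prod_of_nonneg fun j _ => hpos _]
    refine Finset.prod_congr rfl fun j _ => ?_
    rw [ofReal_one_div_one_add_normSq]
    rcases j with l | l <;> simp [φ, weight_neg]
  have hnn : ∀ k : Fin m ⊕ Fin m → ι, 0 ≤ (if freqSum ν k = 0 ∧ ∃ j, ν (k j) ∉ freqBall N then
        ∏ j, 1 / (1 + normSq (ν (k j))) else 0) := by
    intro k
    split_ifs
    · exact Finset.prod_nonneg fun j _ => hpos _
    · exact le_rfl
  rw [← ENNReal.ofReal_le_ofReal_iff (by positivity), ENNReal.ofReal_sum_of_nonneg fun k _ => hnn k,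
    ENNReal.ofReal_mul ENNReal.toReal_nonneg, ENNReal.ofReal_toReal hC]
  refine le_trans ?_ (h N hN)
  refine le_trans (le_of_eq ?_) (ENNReal.tsum_comp_le_tsum_of_injective hφ _)
  rw [tsum_fintype]
  refine Finset.sum_congr rfl fun k _ => ?_
  simp only [hsum, hex, hprod]
  split_ifs <;> simp

/-! ### From the free field to finitely many Gaussians -/

lemma measurable_coeff {s : ℝ} (n : ℤ × ℤ) : Measurable fun u : Sobolev s => u.coeff n := by
  have h0 : Continuous fun f : lp (fun _ : ℤ × ℤ => ℂ) 2 => (f : ℤ × ℤ → ℂ) n :=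
    LipschitzWith.continuous (K := 1) <| LipschitzWith.of_dist_le_mul fun f g => by
      rw [NNReal.coe_one, one_mul, dist_eq_norm f g, dist_eq_norm]
      exact lp.norm_apply_le_norm two_ne_zero (f - g) n
  have h1 : Continuous fun u : Sobolev s => (u.toLp : ℤ × ℤ → ℂ) n :=
    h0.comp (Sobolev.isometry_toLp s).continuous
  have h2 : (fun u : Sobolev s => u.coeff n) =
      fun u => ((bracket n ^ s : ℝ) : ℂ)⁻¹ * (u.toLp : ℤ × ℤ → ℂ) n := by
    funext u
    have h0 : ((bracket n ^ s : ℝ) : ℂ) ≠ 0 := by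
      exact_mod_cast (Real.rpow_pos_of_pos (bracket_pos n) s).ne'
    rw [eq_inv_mul_iff_mul_eq₀ h0]
    rfl
  rw [h2]
  exact (h1.const_mul _).measurable

/-- The normalized Fourier coefficients `⟨n⟩ û(n)`, `|n| ≤ M`. -/
def normCoeff {s : ℝ} (M : ℕ) (u : Sobolev s) : freqBall M → ℂ := fun a => bracket a * u.coeff a

lemma measurable_normCoeff {s : ℝ} (M : ℕ) : Measurable (normCoeff (s := s) M) :=
  measurable_pi_lambda _ fun _ => (measurable_coeff _).const_mul _

/-- Under the free field the normalized Fourier coefficients are independent standard complex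
Gaussians. -/
lemma measurePreserving_normCoeff {s : ℝ} (hs : s < 0) (M : ℕ) :
    MeasurePreserving (normCoeff (s := s) M) (gff s) (gaussPi (freqBall M)) := by
  refine ⟨measurable_normCoeff M, ?_⟩
  rw [gff, Measure.map_map (measurable_normCoeff M) (measurable_gffField s), gaussPi,
    ← Measure.infinitePi_map_restrict (μ := fun _ : ℤ × ℤ => stdComplexGaussian)]
  refine Measure.map_congr ?_
  filter_upwards [ae_memℓp hs] with g hg
  funext a
  have hb : (bracket a : ℂ) ≠ 0 := by exact_mod_cast (bracket_pos (a : ℤ × ℤ)).ne'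
  simp only [Function.comp_apply, normCoeff, gffField, dif_pos hg, Finset.restrict]
  field_simp

/-- The Fourier multiplier of the projection to the ball of radius `N`, divided by `⟨n⟩`. -/
def cutoff (N : ℕ) (n : ℤ × ℤ) : ℝ := if n ∈ freqBall N then (bracket n)⁻¹ else 0

lemma freqBall_mono {N M : ℕ} (h : N ≤ M) : freqBall N ⊆ freqBall M := by
  intro n hn
  have h' : (N : ℤ) ≤ M := by exact_mod_cast h
  simp only [freqBall, Finset.mem_filter, Finset.mem_product, Finset.mem_Icc] at hn ⊢
  obtain ⟨⟨⟨_, _⟩, _, _⟩, h3⟩ := hn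
  refine ⟨⟨⟨?_, ?_⟩, ?_, ?_⟩, ?_⟩ <;> nlinarith

lemma zero_mem_freqBall (N : ℕ) : (0 : ℤ × ℤ) ∈ freqBall N := by
  simp [freqBall]

lemma sum_freqBall_eq {E : Type*} [AddCommMonoid E] {N M : ℕ} (h : N ≤ M) (f : ℤ × ℤ → E)
    (hf : ∀ n ∉ freqBall N, f n = 0) :
    ∑ n ∈ freqBall N, f n = ∑ a : freqBall M, f a := by
  rw [Finset.sum_subset (freqBall_mono h) fun n _ hn => hf n hn]
  exact (Finset.sum_coe_sort (freqBall M) f).symm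

lemma cutoff_sq (N : ℕ) {n : ℤ × ℤ} (hn : n ∈ freqBall N) :
    cutoff N n ^ 2 = 1 / (1 + normSq n) := by
  rw [cutoff, if_pos hn, inv_pow, bracket_sq, one_div]

lemma sum_cutoff_sq {N M : ℕ} (h : N ≤ M) :
    ∑ a : freqBall M, cutoff N a ^ 2 = sigmaN N := by
  rw [sigmaN, ← sum_freqBall_eq h (fun n => cutoff N n ^ 2) fun n hn => by simp [cutoff, hn]]
  exact Finset.sum_congr rfl fun n hn => cutoff_sq N hn

lemma sigmaN_pos (N : ℕ) : 0 < sigmaN N :=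
  Finset.sum_pos (fun n _ => by have := normSq_nonneg n; positivity) ⟨0, zero_mem_freqBall N⟩

/-- Allowing a larger ball `M` lets `G_M` and `G_N` be read off the same Gaussian vector, with only
the cutoffs differing. -/
lemma wickEnergy_eq_finEnergy {s : ℝ} (m : ℕ) {N M : ℕ} (h : N ≤ M) (u : Sobolev s) :
    wickEnergy m N u = 1 / (2 * (m : ℝ)) *
      finEnergy (fun a : freqBall M => (a : ℤ × ℤ)) (fun a => cutoff N a) m (normCoeff M u) := by
  have hp : ∀ x, proj N u x =
      finField (fun a : freqBall M => (a : ℤ × ℤ)) (fun a => cutoff N a) (normCoeff M u) x := by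
    intro x
    rw [finField, proj]
    simp only [normCoeff]
    rw [← sum_freqBall_eq h (fun n => (cutoff N n : ℂ) * mode n x * (bracket n * u.coeff n))
      fun n hn => by simp [cutoff, hn]]
    refine Finset.sum_congr rfl fun n hn => ?_
    have hb : (bracket n : ℂ) ≠ 0 := by exact_mod_cast (bracket_pos n).ne'
    simp only [cutoff, if_pos hn]
    push_cast
    field_simp
  simp only [wickEnergy, wickPower, finEnergy, sum_cutoff_sq h, hp]

lemma measurable_finEnergy {ι : Type*} [Fintype ι] (ν : ι → ℤ × ℤ) (β : ι → ℝ) (m : ℕ) :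
    Measurable (finEnergy ν β m) := by
  have h1 : Measurable fun p : (ι → ℂ) × Torus2 => finField ν β p.1 p.2 := by
    unfold finField
    refine Finset.measurable_fun_sum _ fun a _ => ?_
    have := (continuous_mode (ν a)).measurable
    fun_prop
  have h2 : ∀ σ, Measurable fun x : ℝ => laguerreVar m x σ := fun σ => by
    unfold laguerreVar laguerre
    fun_prop
  exact (StronglyMeasurable.integral_prod_right (f := fun (g : ι → ℂ) (x : Torus2) =>
    (-1) ^ m * (m.factorial : ℝ) * laguerreVar m (‖finField ν β g x‖ ^ 2) (∑ a, β a ^ 2))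
    (((h2 _).comp (h1.norm.pow_const 2)).const_mul _).stronglyMeasurable).measurable

lemma measurable_wickEnergy {s : ℝ} (m N : ℕ) : Measurable (wickEnergy (s := s) m N) := by
  have h : wickEnergy (s := s) m N = fun u => 1 / (2 * (m : ℝ)) * finEnergy
      (fun a : freqBall N => (a : ℤ × ℤ)) (fun a => cutoff N a) m (normCoeff N u) :=
    funext fun u => wickEnergy_eq_finEnergy m le_rfl u
  rw [h]
  exact ((measurable_finEnergy _ _ m).comp (measurable_normCoeff N)).const_mul _

/-! ### Moment bounds for the Wick ordered energy -/

/-- If every frequency lies in the small ball, the two cutoffs agree and the coefficients cancel;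
otherwise the coefficient for `N` vanishes and the one for `M` survives whole. -/
lemma norm_sq_energyCoeff_sub {m N M : ℕ} (k : Fin m ⊕ Fin m → freqBall M) :
    ‖energyCoeff (fun a : freqBall M => (a : ℤ × ℤ)) (fun a => cutoff M a) k -
      energyCoeff (fun a : freqBall M => (a : ℤ × ℤ)) (fun a => cutoff N a) k‖ ^ 2 =
      (2 ^ m * (2 * Real.pi) ^ 2) ^ 2 *
        if freqSum (fun a : freqBall M => (a : ℤ × ℤ)) k = 0 ∧ ∃ j, (k j : ℤ × ℤ) ∉ freqBall N then
          ∏ j, 1 / (1 + normSq (k j)) else 0 := by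
  by_cases h0 : freqSum (fun a : freqBall M => (a : ℤ × ℤ)) k = 0
  · by_cases hN : ∃ j, (k j : ℤ × ℤ) ∉ freqBall N
    · rw [if_pos ⟨h0, hN⟩]
      obtain ⟨j, hj⟩ := hN
      have hz : ∏ j, (cutoff N (k j) : ℂ) = 0 :=
        Finset.prod_eq_zero (Finset.mem_univ j) (by simp [cutoff, hj])
      simp only [energyCoeff, if_pos h0, hz, mul_zero, zero_mul, sub_zero]
      have hM : ∀ j, cutoff M (k j) ^ 2 = 1 / (1 + normSq (k j)) := fun j =>
        cutoff_sq M (k j).2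
      rw [← Finset.prod_congr rfl fun j _ => hM j, Finset.prod_pow]
      have hr : (2 ^ m * (∏ j, (cutoff M (k j) : ℂ)) * (2 * Real.pi) ^ 2 : ℂ) =
          ((2 ^ m * (∏ j, cutoff M (k j)) * (2 * Real.pi) ^ 2 : ℝ) : ℂ) := by push_cast; rfl
      rw [hr, Complex.norm_real, Real.norm_eq_abs, sq_abs]
      ring
    · rw [if_neg fun h => hN h.2, mul_zero]
      push Not at hN
      have hc : ∀ j, cutoff M (k j) = cutoff N (k j) := fun j => by
        rw [cutoff, cutoff, if_pos (k j).2, if_pos (hN j)]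
      simp only [energyCoeff, hc, sub_self, norm_zero]
      norm_num
  · rw [if_neg fun h => h0 h.1, mul_zero]
    simp [energyCoeff, if_neg h0]

lemma eLpNorm_comp_normCoeff {s : ℝ} (hs : s < 0) {M : ℕ} {f : (freqBall M → ℂ) → ℝ}
    (hf : Measurable f) (c : ℝ) (p : ℝ≥0∞) :
    eLpNorm (fun u : Sobolev s => c * f (normCoeff M u)) p (gff s) =
      ‖c‖ₑ * eLpNorm f p (gaussPi (freqBall M)) := by
  rw [← eLpNorm_comp_measurePreserving hf.aestronglyMeasurable (measurePreserving_normCoeff hs M)]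
  exact eLpNorm_const_smul c (f ∘ normCoeff M) p (gff s)

lemma memLp_wickEnergy {s : ℝ} (hs : s < 0) (m N : ℕ) {p : ℝ≥0∞} (hp : p ≠ ∞) :
    MemLp (wickEnergy (s := s) m N) p (gff s) := by
  have := isProbabilityMeasure_gff s
  obtain ⟨k, hk⟩ := ENNReal.exists_nat_gt hp
  have hle : p ≤ ((2 * (k + 1) : ℕ) : ℝ≥0∞) :=
    hk.le.trans (by exact_mod_cast (by omega : k ≤ 2 * (k + 1)))
  refine MemLp.mono_exponent ⟨(measurable_wickEnergy m N).aestronglyMeasurable, ?_⟩ hle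
  have h : wickEnergy (s := s) m N = fun u => 1 / (2 * (m : ℝ)) * finEnergy
      (fun a : freqBall N => (a : ℤ × ℤ)) (fun a => cutoff N a) m (normCoeff N u) :=
    funext fun u => wickEnergy_eq_finEnergy m le_rfl u
  rw [h, eLpNorm_comp_normCoeff hs (measurable_finEnergy _ _ m)]
  exact ENNReal.mul_lt_top enorm_lt_top (eLpNorm_finEnergy_lt_top _ _
    (by rw [sum_cutoff_sq le_rfl]; exact sigmaN_pos N) (by omega))

lemma exists_eLpNorm_sub_le_even {m : ℕ} (hm : 1 ≤ m) : ∃ C : ℝ, 0 ≤ C ∧ ∀ s : ℝ, s < 0 →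
    ∀ k : ℕ, 1 ≤ k → ∀ M N : ℕ, 1 ≤ N → N ≤ M →
      eLpNorm (fun u : Sobolev s => wickEnergy m M u - wickEnergy m N u) ((2 * k : ℕ) : ℝ≥0∞)
        (gff s) ≤ ENNReal.ofReal (C * (k : ℝ) ^ m * (1 / (N : ℝ) ^ (1 / 2 : ℝ))) := by
  obtain ⟨C, hC, h⟩ := exists_sum_tail_le hm
  have hm0 : (0 : ℝ) < m := by exact_mod_cast hm
  -- The factors are the prefactor of the energy, the moment growth without `k ^ m`, the
  -- normalization of the coefficients, and the root of the lattice constant.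
  refine ⟨1 / (2 * (m : ℝ)) * (2 * m : ℝ) ^ m * ((2 ^ m * (2 * Real.pi) ^ 2) * √C),
    by positivity, fun s hs k hk M N hN hNM => ?_⟩
  have e : (fun u : Sobolev s => wickEnergy m M u - wickEnergy m N u) = fun u =>
      1 / (2 * (m : ℝ)) * (fun g =>
        finEnergy (fun a : freqBall M => (a : ℤ × ℤ)) (fun a => cutoff M a) m g -
        finEnergy (fun a : freqBall M => (a : ℤ × ℤ)) (fun a => cutoff N a) m g)
          (normCoeff M u) := by
    funext u
    rw [wickEnergy_eq_finEnergy m le_rfl u, wickEnergy_eq_finEnergy m hNM u]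
    ring
  have hmeas : Measurable fun g =>
      finEnergy (fun a : freqBall M => (a : ℤ × ℤ)) (fun a => cutoff M a) m g -
      finEnergy (fun a : freqBall M => (a : ℤ × ℤ)) (fun a => cutoff N a) m g :=
    (measurable_finEnergy _ _ m).sub (measurable_finEnergy _ _ m)
  rw [e, eLpNorm_comp_normCoeff hs hmeas]
  have h1 := eLpNorm_finEnergy_sub_le (m := m) (fun a : freqBall M => (a : ℤ × ℤ))
    (fun a => cutoff M a) (fun a => cutoff N a)
    (by rw [sum_cutoff_sq le_rfl]; exact sigmaN_pos M)
    (by rw [sum_cutoff_sq hNM]; exact sigmaN_pos N) hk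
  simp only [norm_sq_energyCoeff_sub, ← Finset.mul_sum] at h1
  have h2 := h N hN (freqBall M) (fun a : freqBall M => (a : ℤ × ℤ)) Subtype.val_injective
  rw [← ofReal_norm, Real.norm_of_nonneg (by positivity)]
  refine (mul_le_mul_right h1 _).trans ?_
  rw [← ENNReal.ofReal_mul (by positivity)]
  refine ENNReal.ofReal_le_ofReal ?_
  rw [Real.sqrt_mul (by positivity), Real.sqrt_sq (by positivity)]
  have h3 := Real.sqrt_le_sqrt h2
  rw [Real.sqrt_mul hC, one_div, Real.sqrt_inv, Real.sqrt_eq_rpow (N : ℝ)] at h3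
  calc _ ≤ 1 / (2 * (m : ℝ)) * ((2 * m * k : ℝ) ^ m *
        ((2 ^ m * (2 * Real.pi) ^ 2) * (√C * ((N : ℝ) ^ (1 / 2 : ℝ))⁻¹))) := by gcongr
    _ = _ := by rw [mul_pow (2 * m : ℝ) k, one_div ((N : ℝ) ^ _)]; ring

/-- The quantitative Cauchy estimate for `p ≥ 2`. -/
lemma exists_eLpNorm_sub_le {m : ℕ} (hm : 1 ≤ m) : ∃ C : ℝ, 0 < C ∧ ∀ s : ℝ, s < 0 →
    ∀ p : ℝ, 2 ≤ p → ∀ M N : ℕ, 1 ≤ N → N ≤ M →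
      eLpNorm (fun u : Sobolev s => wickEnergy m M u - wickEnergy m N u) (ENNReal.ofReal p)
        (gff s) ≤ ENNReal.ofReal (C * (p - 1) ^ m * (1 / (N : ℝ) ^ (1 / 2 : ℝ))) := by
  obtain ⟨C, hC, h⟩ := exists_eLpNorm_sub_le_even hm
  -- The added `1` only makes the constant strictly positive.
  refine ⟨C * 2 ^ m + 1, by positivity, fun s hs p hp M N hN hNM => ?_⟩
  have := isProbabilityMeasure_gff s
  set k := ⌈p / 2⌉₊ with hk
  have hk1 : p / 2 ≤ k := Nat.le_ceil _
  have hk2 : (k : ℝ) < p / 2 + 1 := Nat.ceil_lt_add_one (by linarith)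
  have hk0 : 1 ≤ k := Nat.ceil_pos.mpr (by linarith)
  have hpk : ENNReal.ofReal p ≤ ((2 * k : ℕ) : ℝ≥0∞) := by
    rw [← ENNReal.ofReal_natCast]
    refine ENNReal.ofReal_le_ofReal ?_
    push_cast
    linarith
  refine (eLpNorm_le_eLpNorm_of_exponent_le hpk ((measurable_wickEnergy m M).sub
    (measurable_wickEnergy m N)).aestronglyMeasurable).trans ((h s hs k hk0 M N hN hNM).trans ?_)
  refine ENNReal.ofReal_le_ofReal ?_
  have hp1 : 0 ≤ p - 1 := by linarith
  gcongr ?_ * _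
  -- Here `k < p / 2 + 1 ≤ 2 (p - 1)`, the last inequality being equivalent to `p ≥ 2`.
  calc C * (k : ℝ) ^ m ≤ C * (2 * (p - 1)) ^ m := by gcongr; linarith
    _ = C * 2 ^ m * (p - 1) ^ m := by rw [mul_pow]; ring
    _ ≤ (C * 2 ^ m + 1) * (p - 1) ^ m := by gcongr; linarith

/-! ### Convergence -/

/-- Completeness gives a limit for each exponent. Each is also a limit in measure, hence almost
everywhere equal to the `L¹` limit, which serves for all exponents. -/
lemma exists_limit_of_cauchySeq {X : Type*} [MeasurableSpace X] {P : Measure X}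
    [IsProbabilityMeasure P] {f : ℕ → X → ℝ}
    (h : ∀ (p : ℝ≥0∞) [Fact (1 ≤ p)], p ≠ ∞ → ∃ hf : ∀ N, MemLp (f N) p P,
      CauchySeq fun N => (hf N).toLp (f N)) :
    ∃ G : X → ℝ, ∀ p : ℝ≥0∞, 1 ≤ p → p ≠ ∞ → MemLp G p P ∧
      Tendsto (fun N => eLpNorm (fun u => f N u - G u) p P) atTop (𝓝 0) := by
  have key : ∀ p : ℝ≥0∞, 1 ≤ p → p ≠ ∞ → ∃ G : X → ℝ, MemLp G p P ∧
      Tendsto (fun N => eLpNorm (f N - G) p P) atTop (𝓝 0) := by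
    intro p hp hp'
    have : Fact (1 ≤ p) := ⟨hp⟩
    obtain ⟨hf, hc⟩ := h p hp'
    obtain ⟨G, hG⟩ := cauchySeq_tendsto_of_complete hc
    refine ⟨G, Lp.memLp G, ?_⟩
    rw [← Lp.tendsto_Lp_iff_tendsto_eLpNorm'' f hf G (Lp.memLp G), Lp.toLp_coeFn]
    exact hG
  have hmeas : ∀ p : ℝ≥0∞, 1 ≤ p → p ≠ ∞ → ∀ G : X → ℝ, MemLp G p P →
      Tendsto (fun N => eLpNorm (f N - G) p P) atTop (𝓝 0) → TendstoInMeasure P f atTop G := by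
    intro p hp hp' G hG hG'
    have : Fact (1 ≤ p) := ⟨hp⟩
    obtain ⟨hf, -⟩ := h p hp'
    exact tendstoInMeasure_of_tendsto_eLpNorm (zero_lt_one.trans_le hp).ne' (fun N => (hf N).1)
      hG.1 hG'
  obtain ⟨G, hG, hG'⟩ := key 1 le_rfl (by norm_num)
  refine ⟨G, fun p hp hp' => ?_⟩
  obtain ⟨H, hH, hH'⟩ := key p hp hp'
  have hGH : H =ᵐ[P] G := tendstoInMeasure_ae_unique (hmeas p hp hp' H hH hH')
    (hmeas 1 le_rfl (by norm_num) G hG hG')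
  refine ⟨hH.ae_eq hGH, ?_⟩
  refine hH'.congr fun N => eLpNorm_congr_ae ?_
  filter_upwards [hGH] with u hu
  simp [hu]

lemma cauchySeq_toLp_of_eLpNorm_sub_le {X : Type*} [MeasurableSpace X] {P : Measure X}
    {f : ℕ → X → ℝ} {p : ℝ≥0∞} [Fact (1 ≤ p)] (hf : ∀ N, MemLp (f N) p P) (K : ℝ)
    (h : ∀ M N : ℕ, 1 ≤ N → N ≤ M → eLpNorm (fun u => f M u - f N u) p P ≤
      ENNReal.ofReal (K * (1 / (N : ℝ) ^ (1 / 2 : ℝ)))) :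
    CauchySeq fun N => (hf N).toLp (f N) := by
  have hlim : Tendsto (fun N : ℕ => ENNReal.ofReal (K * (1 / (N : ℝ) ^ (1 / 2 : ℝ)))) atTop
      (𝓝 0) := by
    have h1 : Tendsto (fun N : ℕ => K * (1 / (N : ℝ) ^ (1 / 2 : ℝ))) atTop (𝓝 (K * 0)) := by
      refine Tendsto.const_mul K ?_
      simp only [one_div]
      exact ((tendsto_rpow_atTop (by norm_num)).comp tendsto_natCast_atTop_atTop).inv_tendsto_atTop
    rw [mul_zero] at h1
    simpa using ENNReal.tendsto_ofReal h1
  rw [EMetric.cauchySeq_iff']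
  intro ε hε
  obtain ⟨N, hN1, hNε⟩ := ((eventually_ge_atTop 1).and (hlim.eventually_lt_const hε)).exists
  refine ⟨N, fun M hM => ?_⟩
  rw [Lp.edist_toLp_toLp]
  exact (h M N hN1 hM).trans_lt hNε

end WickNLS

end

/-! ### Assembly of the estimates and the limit -/

theorem proposition1p1 (m : ℕ) (hm : 2 ≤ m) :
    -- the constant depends on `m` only
    ∃ C : ℝ, 0 < C ∧ ∀ s : ℝ, s < 0 →
      -- for `1 ≤ p < ∞`, the functions `G_N` lie in `L^p(μ)` and form a Cauchy sequence there
      (∀ (p : ℝ≥0∞) [Fact (1 ≤ p)], p ≠ ∞ →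
        ∃ hG : ∀ N : ℕ, MemLp (WickNLS.wickEnergy m N) p (WickNLS.gff s),
          CauchySeq fun N : ℕ => (hG N).toLp (WickNLS.wickEnergy m N)) ∧
      -- quantitative bound for `p ≥ 2`
      (∀ p : ℝ, 2 ≤ p → ∀ M N : ℕ, 1 ≤ N → N ≤ M →
        eLpNorm (fun u => WickNLS.wickEnergy m M u - WickNLS.wickEnergy m N u)
            (ENNReal.ofReal p) (WickNLS.gff s)
          ≤ ENNReal.ofReal (C * (p - 1) ^ m * (1 / (N : ℝ) ^ (1 / 2 : ℝ)))) ∧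
      -- quantitative bound for `1 ≤ p ≤ 2`
      (∀ p : ℝ, 1 ≤ p → p ≤ 2 → ∀ M N : ℕ, 1 ≤ N → N ≤ M →
        eLpNorm (fun u => WickNLS.wickEnergy m M u - WickNLS.wickEnergy m N u)
            (ENNReal.ofReal p) (WickNLS.gff s)
          ≤ ENNReal.ofReal (C * (1 / (N : ℝ) ^ (1 / 2 : ℝ)))) ∧
      -- the limit `G`, the Wick ordered potential energy, is the same for all `1 ≤ p < ∞`
      (∃ G : WickNLS.Sobolev s → ℝ, ∀ p : ℝ≥0∞, 1 ≤ p → p ≠ ∞ →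
        MemLp G p (WickNLS.gff s) ∧
        Tendsto (fun N : ℕ => eLpNorm (fun u => WickNLS.wickEnergy m N u - G u) p
          (WickNLS.gff s)) atTop (𝓝 0)) := by
  obtain ⟨C, hC, h⟩ := WickNLS.exists_eLpNorm_sub_le (m := m) (by omega)
  refine ⟨C, hC, fun s hs => ?_⟩
  have := WickNLS.isProbabilityMeasure_gff s
  have hmono : ∀ (p q : ℝ≥0∞), p ≤ q → ∀ M N : ℕ,
      eLpNorm (fun u : WickNLS.Sobolev s => WickNLS.wickEnergy m M u - WickNLS.wickEnergy m N u) p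
        (WickNLS.gff s) ≤ eLpNorm (fun u => WickNLS.wickEnergy m M u - WickNLS.wickEnergy m N u) q
        (WickNLS.gff s) := fun p q hpq M N =>
    eLpNorm_le_eLpNorm_of_exponent_le hpq ((WickNLS.measurable_wickEnergy m M).sub
      (WickNLS.measurable_wickEnergy m N)).aestronglyMeasurable
  have hcauchy : ∀ (p : ℝ≥0∞) [Fact (1 ≤ p)], p ≠ ∞ →
      ∃ hG : ∀ N : ℕ, MemLp (WickNLS.wickEnergy m N) p (WickNLS.gff s),
        CauchySeq fun N : ℕ => (hG N).toLp (WickNLS.wickEnergy m N) := by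
    intro p _ hp
    -- The exponent is raised to `max p 2` to enter the range of the quantitative bound; the
    -- constant may depend on `p` here, since only the Cauchy property is at stake.
    refine ⟨fun N => WickNLS.memLp_wickEnergy hs m N hp,
      WickNLS.cauchySeq_toLp_of_eLpNorm_sub_le _ (C * (max p.toReal 2 - 1) ^ m)
        fun M N hN hNM => (hmono _ _ ?_ M N).trans (h s hs _ (le_max_right p.toReal 2) M N hN hNM)⟩
    rw [← ENNReal.ofReal_toReal hp]
    exact ENNReal.ofReal_le_ofReal (by rw [ENNReal.ofReal_toReal hp]; exact le_max_left _ _)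
  refine ⟨hcauchy, h s hs, fun p _ hp M N hN hNM => ?_,
    WickNLS.exists_limit_of_cauchySeq hcauchy⟩
  -- At exponent `2` the factor `(p - 1) ^ m` is `1`, so the same constant covers all smaller
  -- exponents.
  have h2 := h s hs 2 le_rfl M N hN hNM
  rw [show ((2 : ℝ) - 1) = 1 by norm_num, one_pow, mul_one] at h2
  exact (hmono _ _ (ENNReal.ofReal_le_ofReal hp) M N).trans h2
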